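/- Let $n\ge 3$, $m\ge 1$, and let $(\mathbb R^n,g)$ be the pseudo-Euclidean space with coordinates $x=(x_1,\dots,x_n)$ and $g_{ij}=\delta_{ij}\varepsilon_i$, $\varepsilon_i\in\{1,-1\}$. Let $\varphi,f,h:\mathbb R^n\to\mathbb R$ be smooth functions with $\varphi$ nowhere zero and $f>0$, and let $(F^m,g_F)$ be a (non-empty) $m$-dimensional semi-Riemannian Einstein manifold with $\mathrm{Ric}_{g_F}=\lambda_F\, g_F$, $\lambda_F\in\mathbb R$ constant. Let $M=(\mathbb R^n,\bar g)\times_f F^m$ be the warped product, that is, $\mathbb R^n\times F$ with the metric $\tilde g=\bar g+f^2 g_F$, where $\bar g=\frac1{\varphi^2}g$, and regard functions on $\mathbb R^n$ as functions on $M$ through the projection $M\to\mathbb R^n$. Write $u_{,x_i}$ and $u_{,x_ix_j}$ for the first and second partial derivatives of $u:\mathbb R^n\to\mathbb R$. For a smooth function $\rho:\mathbb R^n\to\mathbb R$ consider the system $$(n-2)f\varphi_{,x_ix_j}+f\varphi h_{,x_ix_j}-m\varphi f_{,x_ix_j}-m\varphi_{,x_i}f_{,x_j}-m\varphi_{,x_j}f_{,x_i}+f\varphi_{,x_i}h_{,x_j}+f\varphi_{,x_j}h_{,x_i}=0,\qquad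 1\le i\ne j\le n,\tag{8}$$ $$\varphi\big[(n-2)f\varphi_{,x_ix_i}+f\varphi h_{,x_ix_i}-m\varphi f_{,x_ix_i}-2m\varphi_{,x_i}f_{,x_i}+2f\varphi_{,x_i}h_{,x_i}\big]+\varepsilon_i\sum_{k=1}^n\varepsilon_k\big[f\varphi\varphi_{,x_kx_k}-(n-1)f\varphi_{,x_k}^2+m\varphi\varphi_{,x_k}f_{,x_k}-f\varphi\varphi_{,x_k}h_{,x_k}\big]=\varepsilon_i\rho f,\qquad 1\le i\le n,\tag{9}$$ $$\sum_{k=1}^n\varepsilon_k\big[-f\varphi^2f_{,x_kx_k}+(n-2)f\varphi f_{,x_k}\varphi_{,x_k}-(m-1)\varphi^2f_{,x_k}^2+f\varphi^2f_{,x_k}h_{,x_k}\big]=\rho f^2-\lambda_F.\tag{10}$$ Then for every smooth $\rho:\mathbb R^n\to\mathbb R$ the equation $\mathrm{Ric}_{\tilde g}+\mathrm{Hess}_{\tilde g}(h)=\rho\,\tilde g$ holds on $M$ if and only if $\varphi,f,h,\rho$ satisfy (8), (9) and (10) on $\mathbb R^n$. Moreover, $(M,\tilde g)$ is a gradient Ricci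 almost soliton with potential function $h$, i.e. $\mathrm{Ric}_{\tilde g}+\mathrm{Hess}_{\tilde g}(h)=\tilde\rho\,\tilde g$ for some $\tilde\rho\in C^\infty(M)$, if and only if there is a smooth $\rho:\mathbb R^n\to\mathbb R$ such that $\varphi,f,h,\rho$ satisfy (8), (9) and (10). -/

import Mathlib

open scoped Manifold ContDiff
open Bundle

noncomputable section

namespace SemiRiem

section Coordinates

variable {E : Type*} [NormedAddCommGroup E] [NormedSpace ℝ E]

/-- The Christoffel symbols of the first kind of a field `G` of symmetric bilinear forms on a vector
space: the linear form `w ↦ (∂_u G (v, w) + ∂_v G (u, w) - ∂_w G (u, v)) / 2` at `y`. -/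
def christoffelLower (G : E → E →L[ℝ] E →L[ℝ] ℝ) (y u v : E) : E →L[ℝ] ℝ :=
  (1 / 2 : ℝ) • (fderiv ℝ G y u v + fderiv ℝ G y v u - fderiv ℝ (fun z ↦ G z u v) y)

/-- The Christoffel symbols `Γ(u, v)` of `G` at `y`, that is, the value at `y` of the Levi-Civita
derivative `∇_u v` of the constant vector field `v`.  When `G y` is nondegenerate and `E` is
finite-dimensional, it is the vector with `G y (Γ(u, v)) w = christoffelLower G y u v w`
for all `w`. -/
def christoffel (G : E → E →L[ℝ] E →L[ℝ] ℝ) (y u v : E) : E :=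
  (G y).inverse (christoffelLower G y u v)

/-- The Riemann curvature tensor `R(u, v) w = ∇_u ∇_v w - ∇_v ∇_u w` of `G` at `y`, for constant
vector fields `u`, `v`, `w`. -/
def coordCurvature (G : E → E →L[ℝ] E →L[ℝ] ℝ) (y u v w : E) : E :=
  fderiv ℝ (fun z ↦ christoffel G z v w) y u - fderiv ℝ (fun z ↦ christoffel G z u w) y v
    + christoffel G y u (christoffel G y v w) - christoffel G y v (christoffel G y u w)

/-- The Ricci tensor `Ric(v, w) = trace (u ↦ R(u, v) w)` of `G` at `y`; the trace is computed in a
basis of `E`. -/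
def coordRicci [FiniteDimensional ℝ E] (G : E → E →L[ℝ] E →L[ℝ] ℝ) (y v w : E) : ℝ :=
  ∑ i, (Module.finBasis ℝ E).repr (coordCurvature G y (Module.finBasis ℝ E i) v w) i

/-- The Hessian `Hess h (u, v) = ∂_u ∂_v h - (∇_u v) h` of a function `h` with respect to `G`
at `y`. -/
def coordHess (G : E → E →L[ℝ] E →L[ℝ] ℝ) (h : E → ℝ) (y u v : E) : ℝ :=
  fderiv ℝ (fun z ↦ fderiv ℝ h z v) y u - fderiv ℝ h y (christoffel G y u v)

end Coordinates

section Manifold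

variable {E : Type*} [NormedAddCommGroup E] [NormedSpace ℝ E]
  {H : Type*} [TopologicalSpace H] (I : ModelWithCorners ℝ E H)
  (M : Type*) [TopologicalSpace M] [ChartedSpace H M] [IsManifold I ∞ M]

/-- A smooth semi-Riemannian metric on `M`: a smooth field of symmetric nondegenerate bilinear
forms on the tangent spaces. -/
structure SemiRiemannianMetric where
  inner : ∀ p : M, TangentSpace I p →L[ℝ] TangentSpace I p →L[ℝ] ℝ
  symm : ∀ (p : M) (u v : TangentSpace I p), inner p u v = inner p v u
  nondegenerate : ∀ (p : M) (u : TangentSpace I p), (∀ v, inner p u v = 0) → u = 0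
  contMDiff : ContMDiff I (I.prod 𝓘(ℝ, E →L[ℝ] E →L[ℝ] ℝ)) ∞
    (fun p ↦ TotalSpace.mk' (E →L[ℝ] E →L[ℝ] ℝ) p (inner p))

variable {I M}

/-- A field of bilinear forms on the tangent spaces is smooth at `x₀` if and only if it is smooth
there when read in the trivialization of the tangent bundle around `x₀`. -/
theorem contMDiffAt_bilinForm_iff
    (g : ∀ p : M, TangentSpace I p →L[ℝ] TangentSpace I p →L[ℝ] ℝ) (x₀ : M) :
    ContMDiffAt I (I.prod 𝓘(ℝ, E →L[ℝ] E →L[ℝ] ℝ)) ∞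
      (fun p ↦ TotalSpace.mk' (E →L[ℝ] E →L[ℝ] ℝ) p (g p)) x₀ ↔
    ContMDiffAt I 𝓘(ℝ, E →L[ℝ] E →L[ℝ] ℝ) ∞ (fun p ↦
      let A : E →L[ℝ] E := (trivializationAt E (TangentSpace I) x₀).symmL ℝ p
      let B : E →L[ℝ] E →L[ℝ] ℝ := g p
      B.bilinearComp A A) x₀ := by
  have : IsManifold I 1 M := IsManifold.of_le (n := ∞) (by simp)
  rw [contMDiffAt_hom_bundle]
  refine Iff.trans (and_iff_right contMDiffAt_id) ?_
  apply Filter.EventuallyEq.contMDiffAt_iff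
  filter_upwards [(chartAt H x₀).open_source.mem_nhds (mem_chart_source H x₀)] with p hp
  refine ContinuousLinearMap.ext fun u ↦ ContinuousLinearMap.ext fun v ↦ ?_
  simp only [ContinuousLinearMap.inCoordinates]
  rw [ContinuousLinearMap.comp_apply, Trivialization.continuousLinearMapAt_apply,
    Trivialization.coe_linearMapAt_of_mem _ (by simpa [hom_trivializationAt_baseSet] using hp)]
  have key : ∀ ψ : TangentSpace I p →L[ℝ] ℝ,
      (trivializationAt (E →L[ℝ] ℝ) (fun b : M ↦ TangentSpace I b →L[ℝ] ℝ) x₀ ⟨p, ψ⟩).2 v =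
        ψ ((trivializationAt E (TangentSpace I) x₀).symmL ℝ p v) := by
    intro ψ
    have := hom_trivializationAt_apply (σ := RingHom.id ℝ) (F₁ := E) (E₁ := TangentSpace I) (F₂ := ℝ) (E₂ := fun _ : M ↦ ℝ) x₀ ⟨p, ψ⟩
    erw [this]
    simp [ContinuousLinearMap.inCoordinates]
  exact key _

namespace SemiRiemannianMetric

/-- The expression of the metric in the chart around `p`: the pullback of the metric by the inverse
of that chart. -/
def inChart [I.Boundaryless] (g : SemiRiemannianMetric I M) (p : M) (y : E) : E →L[ℝ] E →L[ℝ] ℝ :=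
  let A : E →L[ℝ] E := mfderiv 𝓘(ℝ, E) I (extChartAt I p).symm y
  let B : E →L[ℝ] E →L[ℝ] ℝ := g.inner ((extChartAt I p).symm y)
  B.bilinearComp A A

/-- The Ricci tensor at `p`, computed in the chart around `p`. -/
def ricci [FiniteDimensional ℝ E] [I.Boundaryless] (g : SemiRiemannianMetric I M) (p : M)
    (u v : TangentSpace I p) : ℝ :=
  let A : TangentSpace I p → E := mfderiv I 𝓘(ℝ, E) (extChartAt I p) p
  coordRicci (g.inChart p) (extChartAt I p p) (A u) (A v)

/-- The Hessian of the function `h` at `p`, computed in the chart around `p`. -/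
def hess [I.Boundaryless] (g : SemiRiemannianMetric I M) (h : M → ℝ) (p : M) (u v : TangentSpace I p) : ℝ :=
  let A : TangentSpace I p → E := mfderiv I 𝓘(ℝ, E) (extChartAt I p) p
  coordHess (g.inChart p) (h ∘ (extChartAt I p).symm) (extChartAt I p p) (A u) (A v)

/-- `g` is an Einstein metric with constant Ricci curvature `c`: `Ric = c g`. -/
def IsEinstein [FiniteDimensional ℝ E] [I.Boundaryless] (g : SemiRiemannianMetric I M) (c : ℝ) : Prop :=
  ∀ (p : M) (u v : TangentSpace I p), g.ricci p u v = c * g.inner p u v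

/-- The equation `Ric + Hess h = ρ g` of a gradient Ricci almost soliton. -/
def AlmostSolitonEquation [FiniteDimensional ℝ E] [I.Boundaryless] (g : SemiRiemannianMetric I M)
    (h ρ : M → ℝ) : Prop :=
  ∀ (p : M) (u v : TangentSpace I p),
    g.ricci p u v + g.hess h p u v = ρ p * g.inner p u v

/-- `(M, g)` is a gradient Ricci almost soliton with potential function `h`: `h` is smooth and
`Ric + Hess h = ρ g` for some `ρ ∈ C^∞(M)`. -/
def IsGradientRicciAlmostSoliton [FiniteDimensional ℝ E] [I.Boundaryless] (g : SemiRiemannianMetric I M)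
    (h : M → ℝ) : Prop :=
  ContMDiff I 𝓘(ℝ, ℝ) ∞ h ∧
    ∃ ρ : M → ℝ, ContMDiff I 𝓘(ℝ, ℝ) ∞ ρ ∧ g.AlmostSolitonEquation h ρ

end SemiRiemannianMetric
end Manifold

section Constructions

theorem contDiff_bilinearComp {E E' : Type*} [NormedAddCommGroup E] [NormedSpace ℝ E]
    [NormedAddCommGroup E'] [NormedSpace ℝ E'] (A : E' →L[ℝ] E) :
    ContDiff ℝ ∞ (fun B : E →L[ℝ] E →L[ℝ] ℝ ↦ B.bilinearComp A A) := by
  have h1 : ContDiff ℝ ∞ (fun B : E →L[ℝ] E →L[ℝ] ℝ ↦ B.comp A) :=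
    contDiff_id.clm_comp contDiff_const
  exact (contDiff_const (c := (ContinuousLinearMap.compL ℝ E' E ℝ).flip A)).clm_comp h1

theorem contDiff_smul_const' {E V : Type*} [NormedAddCommGroup E] [NormedSpace ℝ E]
    [NormedAddCommGroup V] [NormedSpace ℝ V] {c : E → ℝ} (hc : ContDiff ℝ ∞ c) (v : V) :
    ContDiff ℝ ∞ (fun x ↦ c x • v) :=
  hc.smul contDiff_const

variable {E : Type*} [NormedAddCommGroup E] [NormedSpace ℝ E]
  {H : Type*} [TopologicalSpace H] {I : ModelWithCorners ℝ E H}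
  {M : Type*} [TopologicalSpace M] [ChartedSpace H M] [IsManifold I ∞ M]
  {E' : Type*} [NormedAddCommGroup E'] [NormedSpace ℝ E']
  {H' : Type*} [TopologicalSpace H'] {I' : ModelWithCorners ℝ E' H'}
  {M' : Type*} [TopologicalSpace M'] [ChartedSpace H' M'] [IsManifold I' ∞ M']

theorem symmL_trivializationAt_prod {x₀ x : M × M'} (hx : x ∈ (chartAt (ModelProd H H') x₀).source) :
    ((trivializationAt (E × E') (TangentSpace (I.prod I')) x₀).symmL ℝ x : E × E' →L[ℝ] E × E') =
      ContinuousLinearMap.prodMap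
        ((trivializationAt E (TangentSpace I) x₀.1).symmL ℝ x.1 : E →L[ℝ] E)
        ((trivializationAt E' (TangentSpace I') x₀.2).symmL ℝ x.2 : E' →L[ℝ] E') := by
  have : IsManifold I 1 M := IsManifold.of_le (n := ∞) (by simp)
  have : IsManifold I' 1 M' := IsManifold.of_le (n := ∞) (by simp)
  have hx' : x.1 ∈ (chartAt H x₀.1).source ∧ x.2 ∈ (chartAt H' x₀.2).source := by
    simpa [prodChartedSpace_chartAt] using hx
  have hr : Set.range (I.prod I') = Set.range I ×ˢ Set.range I' := by
    exact Set.range_prodMap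
  have key := mfderivWithin_prodMap (I := 𝓘(ℝ, E)) (I' := 𝓘(ℝ, E')) (J := I) (J' := I')
    (s := Set.range I) (t := Set.range I')
    (p := (extChartAt I x₀.1 x.1, extChartAt I' x₀.2 x.2))
    (mdifferentiableWithinAt_extChartAt_symm
      ((extChartAt I x₀.1).map_source (by rw [extChartAt_source]; exact hx'.1)))
    (mdifferentiableWithinAt_extChartAt_symm
      ((extChartAt I' x₀.2).map_source (by rw [extChartAt_source]; exact hx'.2)))
    ((I.uniqueMDiffOn) _ (extChartAt_target_subset_range _
      ((extChartAt I x₀.1).map_source (by rw [extChartAt_source]; exact hx'.1))))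
    ((I'.uniqueMDiffOn) _ (extChartAt_target_subset_range _
      ((extChartAt I' x₀.2).map_source (by rw [extChartAt_source]; exact hx'.2))))
  rw [← modelWithCornersSelf_prod, ← hr, chartedSpaceSelf_prod] at key
  rw [TangentBundle.symmL_trivializationAt hx, TangentBundle.symmL_trivializationAt hx'.1,
    TangentBundle.symmL_trivializationAt hx'.2, extChartAt_prod]
  exact key

/-- The metric `g_M + f ^ 2 g_{M'}` of the warped product `M ×_f M'`. -/
def warpedProduct (g : SemiRiemannianMetric I M) (f : M → ℝ) (hf : ContMDiff I 𝓘(ℝ, ℝ) ∞ f)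
    (hpos : ∀ x, 0 < f x) (g' : SemiRiemannianMetric I' M') :
    SemiRiemannianMetric (I.prod I') (M × M') where
  inner p :=
    let B : E →L[ℝ] E →L[ℝ] ℝ := g.inner p.1
    let B' : E' →L[ℝ] E' →L[ℝ] ℝ := g'.inner p.2
    (B.bilinearComp (ContinuousLinearMap.fst ℝ E E') (ContinuousLinearMap.fst ℝ E E') +
      f p.1 ^ 2 • B'.bilinearComp (ContinuousLinearMap.snd ℝ E E') (ContinuousLinearMap.snd ℝ E E') :
      E × E' →L[ℝ] E × E' →L[ℝ] ℝ)
  symm p u v := by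
    have h1 := g.symm p.1 u.1 v.1
    have h2 := g'.symm p.2 u.2 v.2
    change g.inner p.1 u.1 v.1 + f p.1 ^ 2 * g'.inner p.2 u.2 v.2 =
      g.inner p.1 v.1 u.1 + f p.1 ^ 2 * g'.inner p.2 v.2 u.2
    rw [h1, h2]
  nondegenerate p u h := by
    have h' : ∀ v : E × E', g.inner p.1 u.1 v.1 + f p.1 ^ 2 * g'.inner p.2 u.2 v.2 = 0 := h
    refine Prod.ext (g.nondegenerate p.1 u.1 fun v ↦ ?_) (g'.nondegenerate p.2 u.2 fun v ↦ ?_)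
    · have := h' (v, 0)
      rw [show g'.inner p.2 u.2 (0 : E') = 0 from map_zero (g'.inner p.2 u.2)] at this
      simpa using this
    · have := h' (0, v)
      rw [show g.inner p.1 u.1 (0 : E) = 0 from map_zero (g.inner p.1 u.1)] at this
      simpa [(hpos p.1).ne'] using this
  contMDiff := by
    intro x₀
    refine (contMDiffAt_bilinForm_iff _ _).2 ?_
    have h1 := (contMDiffAt_bilinForm_iff _ _).1 (g.contMDiff x₀.1)
    have h2 := (contMDiffAt_bilinForm_iff _ _).1 (g'.contMDiff x₀.2)
    have h1' := h1.comp x₀ (contMDiffAt_fst (I := I) (J := I'))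
    have h2' := h2.comp x₀ (contMDiffAt_snd (I := I) (J := I'))
    have h1'' := (contDiff_bilinearComp (ContinuousLinearMap.fst ℝ E E')).contMDiff.contMDiffAt.comp x₀ h1'
    have h2'' := (contDiff_bilinearComp (ContinuousLinearMap.snd ℝ E E')).contMDiff.contMDiffAt.comp x₀ h2'
    have h3 : ContMDiffAt (I.prod I') 𝓘(ℝ, ℝ) ∞ (fun p : M × M' ↦ f p.1 ^ 2) x₀ :=
      ((hf x₀.1).comp x₀ contMDiffAt_fst).pow 2
    refine (h1''.add (h3.smul h2'')).congr_of_eventuallyEq ?_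
    filter_upwards [(chartAt (ModelProd H H') x₀).open_source.mem_nhds
      (mem_chart_source (ModelProd H H') x₀)] with p hp
    refine ContinuousLinearMap.ext fun u ↦ ContinuousLinearMap.ext fun v ↦ ?_
    simp only []
    rw [symmL_trivializationAt_prod hp]
    rfl

theorem warpedProduct_inner (g : SemiRiemannianMetric I M) (f : M → ℝ)
    (hf : ContMDiff I 𝓘(ℝ, ℝ) ∞ f) (hpos : ∀ x, 0 < f x) (g' : SemiRiemannianMetric I' M')
    (p : M × M') (u v : E × E') :
    (warpedProduct g f hf hpos g').inner p u v =
      g.inner p.1 u.1 v.1 + f p.1 ^ 2 * g'.inner p.2 u.2 v.2 :=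
  rfl

/-- The pseudo-Euclidean metric `g_{ij} = δ_{ij} ε_i` on `ℝ^n`. -/
def pseudoEuclideanForm {n : ℕ} (ε : Fin n → ℝ) :
    EuclideanSpace ℝ (Fin n) →L[ℝ] EuclideanSpace ℝ (Fin n) →L[ℝ] ℝ :=
  ∑ i, ε i • (EuclideanSpace.proj i : EuclideanSpace ℝ (Fin n) →L[ℝ] ℝ).smulRight
    (EuclideanSpace.proj i : EuclideanSpace ℝ (Fin n) →L[ℝ] ℝ)

theorem pseudoEuclideanForm_apply {n : ℕ} (ε : Fin n → ℝ) (u v : EuclideanSpace ℝ (Fin n)) :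
    pseudoEuclideanForm ε u v = ∑ i, ε i * (u i * v i) := by
  simp [pseudoEuclideanForm]

theorem pseudoEuclideanForm_symm {n : ℕ} (ε : Fin n → ℝ) (u v : EuclideanSpace ℝ (Fin n)) :
    pseudoEuclideanForm ε u v = pseudoEuclideanForm ε v u := by
  simp only [pseudoEuclideanForm_apply, mul_comm]

theorem pseudoEuclideanForm_nondegenerate {n : ℕ} {ε : Fin n → ℝ} (hε : ∀ i, ε i = 1 ∨ ε i = -1)
    (u : EuclideanSpace ℝ (Fin n)) (h : ∀ v, pseudoEuclideanForm ε u v = 0) : u = 0 := by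
  ext i
  have := h (EuclideanSpace.single i 1)
  have hi : ε i ≠ 0 := by rcases hε i with h | h <;> simp [h]
  simpa [pseudoEuclideanForm_apply, hi] using this

/-- The metric `g / φ ^ 2` on `ℝ^n`, where `g` is the pseudo-Euclidean metric
`g_{ij} = δ_{ij} ε_i`. -/
def conformalMetric {n : ℕ} (ε : Fin n → ℝ) (hε : ∀ i, ε i = 1 ∨ ε i = -1)
    (φ : EuclideanSpace ℝ (Fin n) → ℝ) (hφ : ContDiff ℝ ∞ φ) (hφ0 : ∀ x, φ x ≠ 0) :
    SemiRiemannianMetric (𝓡 n) (EuclideanSpace ℝ (Fin n)) where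
  inner x := ((1 / φ x ^ 2) • pseudoEuclideanForm ε :
    EuclideanSpace ℝ (Fin n) →L[ℝ] EuclideanSpace ℝ (Fin n) →L[ℝ] ℝ)
  symm p u v := congrArg (1 / φ p ^ 2 * ·) (pseudoEuclideanForm_symm ε u v)
  nondegenerate p u h := pseudoEuclideanForm_nondegenerate hε u fun v ↦ by
    have : 1 / φ p ^ 2 * pseudoEuclideanForm ε u v = 0 := h v
    exact (mul_eq_zero.1 this).resolve_left (by simp [hφ0])
  contMDiff := by
    intro x₀
    refine (contMDiffAt_bilinForm_iff _ _).2 ?_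
    simp only [TangentBundle.symmL_model_space]
    have h : ContDiff ℝ ∞ (fun x ↦ 1 / φ x ^ 2) := contDiff_const.div (hφ.pow 2) (by simp [hφ0])
    exact (contDiff_smul_const' h (pseudoEuclideanForm ε)).contMDiff x₀

theorem conformalMetric_inner {n : ℕ} (ε : Fin n → ℝ) (hε : ∀ i, ε i = 1 ∨ ε i = -1)
    (φ : EuclideanSpace ℝ (Fin n) → ℝ) (hφ : ContDiff ℝ ∞ φ) (hφ0 : ∀ x, φ x ≠ 0)
    (x u v : EuclideanSpace ℝ (Fin n)) :
    (conformalMetric ε hε φ hφ hφ0).inner x u v = 1 / φ x ^ 2 * ∑ i, ε i * (u i * v i) := by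
  rw [← pseudoEuclideanForm_apply]
  rfl

/-- The partial derivative `∂u/∂x_i` of a function on `ℝ^n`. -/
def partialDeriv {n : ℕ} (i : Fin n) (u : EuclideanSpace ℝ (Fin n) → ℝ)
    (x : EuclideanSpace ℝ (Fin n)) : ℝ :=
  fderiv ℝ u x (EuclideanSpace.single i 1)

/-- The system of partial differential equations of the warped product
`(ℝ^n, g / φ ^ 2) ×_f F`, where `g_{ij} = δ_{ij} ε_i` and `F` is an Einstein manifold of dimension
`m` with constant Ricci curvature `c`. -/
structure WarpedSolitonSystem {n : ℕ} (ε : Fin n → ℝ) (m : ℕ) (c : ℝ)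
    (φ f h ρ : EuclideanSpace ℝ (Fin n) → ℝ) : Prop where
  offDiagonal : ∀ (x : EuclideanSpace ℝ (Fin n)) (i j : Fin n), i ≠ j →
    ((n : ℝ) - 2) * f x * partialDeriv j (partialDeriv i φ) x
      + f x * φ x * partialDeriv j (partialDeriv i h) x
      - m * φ x * partialDeriv j (partialDeriv i f) x
      - m * partialDeriv i φ x * partialDeriv j f x
      - m * partialDeriv j φ x * partialDeriv i f x
      + f x * partialDeriv i φ x * partialDeriv j h x
      + f x * partialDeriv j φ x * partialDeriv i h x = 0
  diagonal : ∀ (x : EuclideanSpace ℝ (Fin n)) (i : Fin n),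
    φ x * (((n : ℝ) - 2) * f x * partialDeriv i (partialDeriv i φ) x
        + f x * φ x * partialDeriv i (partialDeriv i h) x
        - m * φ x * partialDeriv i (partialDeriv i f) x
        - 2 * m * partialDeriv i φ x * partialDeriv i f x
        + 2 * f x * partialDeriv i φ x * partialDeriv i h x)
      + ε i * ∑ k, ε k * (f x * φ x * partialDeriv k (partialDeriv k φ) x
        - ((n : ℝ) - 1) * f x * partialDeriv k φ x ^ 2
        + m * φ x * partialDeriv k φ x * partialDeriv k f x
        - f x * φ x * partialDeriv k φ x * partialDeriv k h x)
      = ε i * ρ x * f x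
  fiber : ∀ x : EuclideanSpace ℝ (Fin n),
    ∑ k, ε k * (-(f x * φ x ^ 2 * partialDeriv k (partialDeriv k f) x)
        + ((n : ℝ) - 2) * f x * φ x * partialDeriv k f x * partialDeriv k φ x
        - ((m : ℝ) - 1) * φ x ^ 2 * partialDeriv k f x ^ 2
        + f x * φ x ^ 2 * partialDeriv k f x * partialDeriv k h x)
      = ρ x * f x ^ 2 - c

end Constructions

end SemiRiem

end

/-! The soliton equation is an identity of bilinear forms at each point p, so it can be checked in
the product chart around p, where the metric is the block form A + f² B. Here A = q / φ² with q
constant, and B is the fibre metric read in its chart. The Koszul formula gives the Christoffel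
symbols of this form (`christoffel_warpedForm`). Only the two diagonal blocks of the curvature enter
the trace, and they yield Ric = Ric_A - (m / f) Hess_A f + Ric_B - (f Δ_A f + (m - 1) |∇f|²) B and
Hess h = Hess_A h + f ⟨∇f, ∇h⟩ B (`coordRicci_warpedForm`, `coordHess_warpedForm`).

Since F is Einstein, Ric_B is a multiple of B, and the whole vertical part is a scalar times B. As B
is nonzero, the equation splits into a tensor equation on the base and one scalar equation
(`forall_prod_bilin_eq_iff`). The formulas for a metric conformal to a constant form make both
explicit. On pairs of coordinate vectors the base equation becomes `offDiagonal` after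
multiplication by φ f and `diagonal` after multiplication by φ² f (`base_equation_iff`); the scalar
equation is `fiber` (`fiber_equation_iff`).

The equivalence at p involves ρ only through its value there, and the system does not see the fibre
coordinate. Hence an arbitrary smooth function on M solving the soliton equation can be restricted
to a slice ℝ^n × {q₀}, and the restriction solves the system. -/

noncomputable section

namespace SemiRiem

/-! ### Christoffel symbols and curvature of a field of bilinear forms -/

section Coordinates

variable {E : Type*} [NormedAddCommGroup E] [NormedSpace ℝ E]
  {G G' : E → E →L[ℝ] E →L[ℝ] ℝ} {y : E}

theorem trilin_add₁ (D : E →L[ℝ] E →L[ℝ] E →L[ℝ] ℝ) (u u' v w : E) :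
    D (u + u') v w = D u v w + D u' v w := by
  rw [ContinuousLinearMap.map_add D]
  rfl

theorem trilin_add₂ (D : E →L[ℝ] E →L[ℝ] E →L[ℝ] ℝ) (u v v' w : E) :
    D u (v + v') w = D u v w + D u v' w := by
  rw [ContinuousLinearMap.map_add (D u)]
  rfl

theorem trilin_add₃ (D : E →L[ℝ] E →L[ℝ] E →L[ℝ] ℝ) (u v w w' : E) :
    D u v (w + w') = D u v w + D u v w' :=
  ContinuousLinearMap.map_add (D u v) w w'

theorem trilin_smul₁ (D : E →L[ℝ] E →L[ℝ] E →L[ℝ] ℝ) (c : ℝ) (u v w : E) :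
    D (c • u) v w = c * D u v w := by
  rw [ContinuousLinearMap.map_smul D]
  rfl

theorem trilin_smul₂ (D : E →L[ℝ] E →L[ℝ] E →L[ℝ] ℝ) (c : ℝ) (u v w : E) :
    D u (c • v) w = c * D u v w := by
  rw [ContinuousLinearMap.map_smul (D u)]
  rfl

theorem trilin_smul₃ (D : E →L[ℝ] E →L[ℝ] E →L[ℝ] ℝ) (c : ℝ) (u v w : E) :
    D u v (c • w) = c * D u v w :=
  ContinuousLinearMap.map_smul (D u v) c w

theorem fderiv_apply_apply (hG : DifferentiableAt ℝ G y) (u v w : E) :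
    fderiv ℝ (fun z ↦ G z u v) y w = fderiv ℝ G y w u v := by
  have h := (hG.hasFDerivAt.clm_apply (hasFDerivAt_const u y)).clm_apply (hasFDerivAt_const v y)
  rw [h.fderiv]
  simp

theorem christoffelLower_apply (hG : DifferentiableAt ℝ G y) (u v w : E) :
    christoffelLower G y u v w =
      1 / 2 * (fderiv ℝ G y u v w + fderiv ℝ G y v u w - fderiv ℝ G y w u v) := by
  simp [christoffelLower, fderiv_apply_apply hG]

theorem fderiv_bilin_symm (hG : DifferentiableAt ℝ G y) (hs : ∀ z u v, G z u v = G z v u)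
    (u v w : E) : fderiv ℝ G y u v w = fderiv ℝ G y u w v := by
  rw [← fderiv_apply_apply hG, ← fderiv_apply_apply hG]
  simp only [hs _ v w]

theorem christoffelLower_comm (hG : DifferentiableAt ℝ G y) (hs : ∀ z u v, G z u v = G z v u)
    (u v : E) : christoffelLower G y u v = christoffelLower G y v u := by
  ext w
  rw [christoffelLower_apply hG, christoffelLower_apply hG, fderiv_bilin_symm hG hs w u v]
  ring

theorem christoffel_comm (hG : DifferentiableAt ℝ G y) (hs : ∀ z u v, G z u v = G z v u)
    (u v : E) : christoffel G y u v = christoffel G y v u := by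
  rw [christoffel, christoffelLower_comm hG hs, christoffel]

theorem apply_christoffel (hi : (G y).IsInvertible) (u v w : E) :
    G y (christoffel G y u v) w = christoffelLower G y u v w := by
  rw [christoffel, hi.self_apply_inverse]

/-- Nondegeneracy makes the Koszul formula characterize the Christoffel symbols. Closed expressions
for them are verified below by pairing with an arbitrary vector. -/
theorem christoffel_eq (hi : (G y).IsInvertible) {u v c : E}
    (h : ∀ w, G y c w = christoffelLower G y u v w) : christoffel G y u v = c := by
  refine hi.injective (ContinuousLinearMap.ext fun w ↦ ?_)
  rw [apply_christoffel hi, h]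

/-- `inverse` is a linear map even where `G y` is degenerate (it is then zero), so linearity of the
Christoffel symbols needs no invertibility. -/
theorem christoffel_add_left (hG : DifferentiableAt ℝ G y) (u u' v : E) :
    christoffel G y (u + u') v = christoffel G y u v + christoffel G y u' v := by
  rw [christoffel, christoffel, christoffel, ← map_add]
  congr 1
  ext w
  rw [add_apply, christoffelLower_apply hG, christoffelLower_apply hG, christoffelLower_apply hG]
  simp only [trilin_add₁, trilin_add₂]
  ring

theorem christoffel_smul_left (hG : DifferentiableAt ℝ G y) (c : ℝ) (u v : E) :
    christoffel G y (c • u) v = c • christoffel G y u v := by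
  rw [christoffel, christoffel, ← map_smul]
  congr 1
  ext w
  rw [smul_apply, christoffelLower_apply hG, christoffelLower_apply hG]
  simp only [trilin_smul₁, trilin_smul₂]
  ring

theorem christoffel_add_right (hG : DifferentiableAt ℝ G y) (u v v' : E) :
    christoffel G y u (v + v') = christoffel G y u v + christoffel G y u v' := by
  rw [christoffel, christoffel, christoffel, ← map_add]
  congr 1
  ext w
  rw [add_apply, christoffelLower_apply hG, christoffelLower_apply hG, christoffelLower_apply hG]
  simp only [trilin_add₁, trilin_add₂, trilin_add₃]
  ring

theorem christoffel_smul_right (hG : DifferentiableAt ℝ G y) (c : ℝ) (u v : E) :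
    christoffel G y u (c • v) = c • christoffel G y u v := by
  rw [christoffel, christoffel, ← map_smul]
  congr 1
  ext w
  rw [smul_apply, christoffelLower_apply hG, christoffelLower_apply hG]
  simp only [trilin_smul₁, trilin_smul₂, trilin_smul₃]
  ring

theorem christoffel_zero_left (hG : DifferentiableAt ℝ G y) (v : E) :
    christoffel G y 0 v = 0 := by
  simpa using christoffel_smul_left hG 0 0 v

theorem christoffel_sub_right (hG : DifferentiableAt ℝ G y) (u v v' : E) :
    christoffel G y u (v - v') = christoffel G y u v - christoffel G y u v' := by
  rw [eq_sub_iff_add_eq, ← christoffel_add_right hG, sub_add_cancel]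

theorem eventually_differentiableAt {V : Type*} [NormedAddCommGroup V] [NormedSpace ℝ V]
    {G : E → V} (hG : ContDiffAt ℝ ∞ G y) :
    ∀ᶠ z in nhds y, DifferentiableAt ℝ G z := by
  filter_upwards [(hG.of_le (m := 1) (by simp)).eventually (by simp)] with z hz
  exact hz.differentiableAt (by simp)

theorem contDiffAt_fderiv_apply {V : Type*} [NormedAddCommGroup V] [NormedSpace ℝ V]
    {f : E → V} (hf : ContDiffAt ℝ ∞ f y) (u : E) : ContDiffAt ℝ ∞ (fun z ↦ fderiv ℝ f z u) y :=
  (hf.fderiv_right (m := ∞) (by simp)).clm_apply contDiffAt_const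

theorem fderiv_fderiv_apply {V : Type*} [NormedAddCommGroup V] [NormedSpace ℝ V]
    {f : E → V} (hf : ContDiffAt ℝ ∞ f y) (u v : E) :
    fderiv ℝ (fun z ↦ fderiv ℝ f z v) y u = fderiv ℝ (fderiv ℝ f) y u v := by
  have h := ((hf.fderiv_right (m := ∞) (by simp)).differentiableAt (by simp)).hasFDerivAt.clm_apply
    (hasFDerivAt_const v y)
  rw [h.fderiv]
  simp

theorem fderiv_fderiv_comm {f : E → ℝ} (hf : ContDiffAt ℝ ∞ f y) (u v : E) :
    fderiv ℝ (fderiv ℝ f) y u v = fderiv ℝ (fderiv ℝ f) y v u :=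
  hf.isSymmSndFDerivAt (by simp; exact WithTop.coe_le_coe.2 le_top) u v

section

variable [CompleteSpace E]

theorem contDiffAt_inverse (hG : ContDiffAt ℝ ∞ G y) (hi : (G y).IsInvertible) :
    ContDiffAt ℝ ∞ (fun z ↦ (G z).inverse) y :=
  hi.contDiffAt_map_inverse.comp y hG

theorem eventually_isInvertible (hG : ContinuousAt G y) (hi : (G y).IsInvertible) :
    ∀ᶠ z in nhds y, (G z).IsInvertible := by
  obtain ⟨e, he⟩ := hi
  filter_upwards [hG.eventually (he ▸ e.nhds)] with z hz
  exact hz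

theorem contDiffAt_christoffel (hG : ContDiffAt ℝ ∞ G y) (hi : (G y).IsInvertible) (u v : E) :
    ContDiffAt ℝ ∞ (fun z ↦ christoffel G z u v) y := by
  refine (contDiffAt_inverse hG hi).clm_apply ?_
  refine ContDiffAt.const_smul (1 / 2 : ℝ) ?_
  refine ContDiffAt.sub (ContDiffAt.add ?_ ?_) ?_
  · exact (contDiffAt_fderiv_apply hG u).clm_apply contDiffAt_const
  · exact (contDiffAt_fderiv_apply hG v).clm_apply contDiffAt_const
  · exact ContDiffAt.fderiv_right (m := ∞)
      ((hG.clm_apply contDiffAt_const).clm_apply contDiffAt_const) (by simp)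

theorem differentiableAt_christoffel (hG : ContDiffAt ℝ ∞ G y) (hi : (G y).IsInvertible)
    (u v : E) : DifferentiableAt ℝ (fun z ↦ christoffel G z u v) y :=
  (contDiffAt_christoffel hG hi u v).differentiableAt (by simp)

/-- The curvature tensor as a linear map in its first argument. -/
def coordCurvatureLinear (hG : ContDiffAt ℝ ∞ G y) (hi : (G y).IsInvertible) (v w : E) :
    E →ₗ[ℝ] E where
  toFun u := coordCurvature G y u v w
  map_add' u u' := by
    have hd := eventually_differentiableAt hG
    have h1 : (fun z ↦ christoffel G z (u + u') w) =ᶠ[nhds y]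
        fun z ↦ christoffel G z u w + christoffel G z u' w := by
      filter_upwards [hd] with z hz using christoffel_add_left hz u u' w
    have h2 := fderiv_fun_add (differentiableAt_christoffel hG hi u w)
      (differentiableAt_christoffel hG hi u' w)
    simp only [coordCurvature]
    rw [h1.fderiv_eq, h2, christoffel_add_left hd.self_of_nhds,
      christoffel_add_left hd.self_of_nhds, christoffel_add_right hd.self_of_nhds, map_add,
      add_apply]
    abel
  map_smul' c u := by
    have hd := eventually_differentiableAt hG
    have h1 : (fun z ↦ christoffel G z (c • u) w) =ᶠ[nhds y]
        fun z ↦ c • christoffel G z u w := by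
      filter_upwards [hd] with z hz using christoffel_smul_left hz c u w
    have h2 := fderiv_fun_const_smul (differentiableAt_christoffel hG hi u w) c
    simp only [coordCurvature]
    rw [h1.fderiv_eq, h2, christoffel_smul_left hd.self_of_nhds,
      christoffel_smul_left hd.self_of_nhds, christoffel_smul_right hd.self_of_nhds, map_smul,
      smul_apply]
    simp only [RingHom.id_apply, smul_sub, smul_add]

end

/-- The curvature differentiates Christoffel symbols, which already contain a derivative of the
form. Equality at y alone is not enough; equality near y passes to the germs at all nearby points.
-/
theorem coordCurvature_congr (h : G =ᶠ[nhds y] G') (u v w : E) :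
    coordCurvature G y u v w = coordCurvature G' y u v w := by
  have key : ∀ u v, (fun z ↦ christoffel G z u v) =ᶠ[nhds y] fun z ↦ christoffel G' z u v := by
    intro u v
    filter_upwards [h, h.eventuallyEq_nhds] with z hz hz'
    have h' : (fun z ↦ G z u v) =ᶠ[nhds z] fun z ↦ G' z u v := by
      filter_upwards [hz'] with t ht
      rw [ht]
    simp only [christoffel, christoffelLower, hz, hz'.fderiv_eq, h'.fderiv_eq]
  simp only [coordCurvature, (key _ _).fderiv_eq, (key _ _).self_of_nhds]

theorem christoffel_congr (h : G =ᶠ[nhds y] G') (u v : E) :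
    christoffel G y u v = christoffel G' y u v := by
  have h' : (fun z ↦ G z u v) =ᶠ[nhds y] fun z ↦ G' z u v := by
    filter_upwards [h] with t ht
    rw [ht]
  simp only [christoffel, christoffelLower, h.self_of_nhds, h.fderiv_eq, h'.fderiv_eq]

/-! ### Traces and the Ricci tensor in an arbitrary basis -/

section Trace

theorem sum_repr_eq_trace {ι : Type*} [Fintype ι] (b : Module.Basis ι ℝ E) (L : E →ₗ[ℝ] E) :
    ∑ i, b.repr (L (b i)) i = LinearMap.trace ℝ E L := by
  classical
  rw [LinearMap.trace_eq_matrix_trace ℝ b, Matrix.trace]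
  simp [LinearMap.toMatrix_apply]

theorem coordRicci_eq_trace [FiniteDimensional ℝ E] (hG : ContDiffAt ℝ ∞ G y) (hi : (G y).IsInvertible) (v w : E) :
    coordRicci G y v w = LinearMap.trace ℝ E (coordCurvatureLinear hG hi v w) :=
  sum_repr_eq_trace _ (coordCurvatureLinear hG hi v w)

/-- The Ricci sum is the trace of a linear map, hence independent of the basis. This permits a basis
adapted to a product. -/
theorem coordRicci_eq_sum [FiniteDimensional ℝ E] {ι : Type*} [Fintype ι] (b : Module.Basis ι ℝ E)
    (hG : ContDiffAt ℝ ∞ G y) (hi : (G y).IsInvertible) (v w : E) :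
    coordRicci G y v w = ∑ i, b.repr (coordCurvature G y (b i) v w) i := by
  rw [coordRicci_eq_trace hG hi, ← sum_repr_eq_trace b]
  rfl

theorem coordRicci_congr [FiniteDimensional ℝ E] (h : G =ᶠ[nhds y] G') (v w : E) :
    coordRicci G y v w = coordRicci G' y v w := by
  simp only [coordRicci, coordCurvature_congr h]

theorem coordHess_congr {h h' : E → ℝ} (hG : G =ᶠ[nhds y] G') (hh : h =ᶠ[nhds y] h') (u v : E) :
    coordHess G h y u v = coordHess G' h' y u v := by
  have : (fun z ↦ fderiv ℝ h z v) =ᶠ[nhds y] fun z ↦ fderiv ℝ h' z v := by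
    filter_upwards [hh.eventuallyEq_nhds] with t ht
    rw [ht.fderiv_eq]
  simp only [coordHess, this.fderiv_eq, hh.fderiv_eq, christoffel_congr hG]

/-- A linear form on a finite-dimensional space, evaluated at a vector, is a trace. -/
theorem sum_repr_smul {ι : Type*} [Fintype ι] (b : Module.Basis ι ℝ E) (a : E →ₗ[ℝ] ℝ) (v : E) :
    ∑ i, a (b i) * b.repr v i = a v := by
  conv_rhs => rw [← b.sum_repr v]
  simp only [map_sum, map_smul, smul_eq_mul, mul_comm]

theorem sum_repr_self {ι : Type*} [Fintype ι] (b : Module.Basis ι ℝ E) :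
    ∑ i, b.repr (b i) i = Module.finrank ℝ E := by
  simp [Module.finrank_eq_card_basis b]

/-- Nondegeneracy is injectivity into the dual, which has the same finite dimension. -/
theorem isInvertible_of_nondegenerate [FiniteDimensional ℝ E] (B : E →L[ℝ] E →L[ℝ] ℝ)
    (h : ∀ u, (∀ v, B u v = 0) → u = 0) : B.IsInvertible := by
  have hinj : Function.Injective (B : E →ₗ[ℝ] E →L[ℝ] ℝ) := by
    rw [injective_iff_map_eq_zero]
    intro u hu
    exact h u fun v ↦ by rw [show B u = 0 from hu]; rfl
  have hdim : Module.finrank ℝ E = Module.finrank ℝ (E →L[ℝ] ℝ) := by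
    rw [← (LinearMap.toContinuousLinearMap (𝕜 := ℝ) (E := E) (F' := ℝ)).finrank_eq]
    exact (Subspace.dual_finrank_eq (K := ℝ) (V := E)).symm
  refine ⟨(LinearEquiv.ofInjectiveOfFinrankEq (B : E →ₗ[ℝ] E →L[ℝ] ℝ) hinj
    hdim).toContinuousLinearEquiv, ?_⟩
  ext u v
  rfl

end Trace

end Coordinates

/-! ### Christoffel symbols of a warped product -/

section WarpedCoordinates

variable {E : Type*} [NormedAddCommGroup E] [NormedSpace ℝ E]
  {E' : Type*} [NormedAddCommGroup E'] [NormedSpace ℝ E']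

/-- The gradient of a function with respect to a field of bilinear forms. -/
def coordGrad (A : E → E →L[ℝ] E →L[ℝ] ℝ) (f : E → ℝ) (y : E) : E :=
  (A y).inverse (fderiv ℝ f y)

/-- The covariant derivative of the gradient of a function. -/
def coordDerivGrad (A : E → E →L[ℝ] E →L[ℝ] ℝ) (f : E → ℝ) (y u : E) : E :=
  fderiv ℝ (coordGrad A f) y u + christoffel A y u (coordGrad A f y)

/-- The Laplacian of a function, the trace of the covariant derivative of its gradient. -/
def coordLaplacian [FiniteDimensional ℝ E] (A : E → E →L[ℝ] E →L[ℝ] ℝ) (f : E → ℝ) (y : E) : ℝ :=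
  ∑ i, (Module.finBasis ℝ E).repr (coordDerivGrad A f y (Module.finBasis ℝ E i)) i

/-- The field of bilinear forms `A + f ^ 2 B` on a product. -/
def warpedForm (A : E → E →L[ℝ] E →L[ℝ] ℝ) (f : E → ℝ) (B : E' → E' →L[ℝ] E' →L[ℝ] ℝ)
    (p : E × E') : E × E' →L[ℝ] E × E' →L[ℝ] ℝ :=
  (A p.1).bilinearComp (ContinuousLinearMap.fst ℝ E E') (ContinuousLinearMap.fst ℝ E E') +
    f p.1 ^ 2 • (B p.2).bilinearComp (ContinuousLinearMap.snd ℝ E E')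
      (ContinuousLinearMap.snd ℝ E E')

theorem fderiv_comp_fst_apply {V : Type*} [NormedAddCommGroup V] [NormedSpace ℝ V] {g : E → V}
    {p : E × E'} (hg : DifferentiableAt ℝ g p.1) (u : E × E') :
    fderiv ℝ (fun z : E × E' ↦ g z.1) p u = fderiv ℝ g p.1 u.1 := by
  exact congrArg (fun L ↦ L u) (hg.hasFDerivAt.comp p hasFDerivAt_fst).fderiv

theorem fderiv_comp_snd_apply {V : Type*} [NormedAddCommGroup V] [NormedSpace ℝ V] {g : E' → V}
    {p : E × E'} (hg : DifferentiableAt ℝ g p.2) (u : E × E') :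
    fderiv ℝ (fun z : E × E' ↦ g z.2) p u = fderiv ℝ g p.2 u.2 := by
  exact congrArg (fun L ↦ L u) (hg.hasFDerivAt.comp p hasFDerivAt_snd).fderiv

theorem contDiffAt_smul' {k : ℕ∞ω} {V : Type*} [NormedAddCommGroup V] [NormedSpace ℝ V] {c : E → ℝ}
    {g : E → V} {y : E} (hc : ContDiffAt ℝ k c y) (hg : ContDiffAt ℝ k g y) :
    ContDiffAt ℝ k (fun z ↦ c z • g z) y :=
  hc.smul hg

theorem bilin_add_left (B : E →L[ℝ] E →L[ℝ] ℝ) (u u' v : E) :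
    B (u + u') v = B u v + B u' v := by
  rw [ContinuousLinearMap.map_add B]
  rfl

theorem bilin_sub_left (B : E →L[ℝ] E →L[ℝ] ℝ) (u u' v : E) :
    B (u - u') v = B u v - B u' v := by
  rw [ContinuousLinearMap.map_sub B]
  rfl

theorem bilin_smul_left (B : E →L[ℝ] E →L[ℝ] ℝ) (c : ℝ) (u v : E) :
    B (c • u) v = c * B u v := by
  rw [ContinuousLinearMap.map_smul B]
  rfl

variable {A : E → E →L[ℝ] E →L[ℝ] ℝ} {f : E → ℝ} {B : E' → E' →L[ℝ] E' →L[ℝ] ℝ} {p : E × E'}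

theorem warpedForm_apply (p u v : E × E') :
    warpedForm A f B p u v = A p.1 u.1 v.1 + f p.1 ^ 2 * B p.2 u.2 v.2 :=
  rfl

theorem contDiffAt_warpedForm {k : ℕ∞ω} (hk : k ≤ ∞)
    (hA : ContDiffAt ℝ k A p.1) (hf : ContDiffAt ℝ k f p.1)
    (hB : ContDiffAt ℝ k B p.2) : ContDiffAt ℝ k (warpedForm A f B) p :=
  (((contDiff_bilinearComp (ContinuousLinearMap.fst ℝ E E')).contDiffAt.of_le hk ).comp p
    (hA.comp p contDiffAt_fst)).add
    (contDiffAt_smul' ((hf.comp p contDiffAt_fst).pow 2)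
      (((contDiff_bilinearComp (ContinuousLinearMap.snd ℝ E E')).contDiffAt.of_le hk ).comp p
        (hB.comp p contDiffAt_snd)))

theorem isInvertible_warpedForm [FiniteDimensional ℝ E] [FiniteDimensional ℝ E']
    (hA : (A p.1).IsInvertible) (hf : f p.1 ≠ 0) (hB : (B p.2).IsInvertible) :
    (warpedForm A f B p).IsInvertible := by
  refine isInvertible_of_nondegenerate _ fun u hu ↦ Prod.ext (hA.injective ?_) (hB.injective ?_)
  · ext v
    have := hu (v, 0)
    rw [warpedForm_apply, ContinuousLinearMap.map_zero (B p.2 u.2)] at this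
    simpa using this
  · ext v
    have := hu (0, v)
    rw [warpedForm_apply, ContinuousLinearMap.map_zero (A p.1 u.1)] at this
    simpa [hf] using this

theorem fderiv_warpedForm [FiniteDimensional ℝ E] [FiniteDimensional ℝ E']
    (hA : ContDiffAt ℝ 1 A p.1) (hf : ContDiffAt ℝ 1 f p.1)
    (hB : ContDiffAt ℝ 1 B p.2) (u v w : E × E') :
    fderiv ℝ (warpedForm A f B) p u v w = fderiv ℝ A p.1 u.1 v.1 w.1 +
      (2 * f p.1 * fderiv ℝ f p.1 u.1 * B p.2 v.2 w.2 +
        f p.1 ^ 2 * fderiv ℝ B p.2 u.2 v.2 w.2) := by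
  have hA' := hA.differentiableAt (by simp)
  have hB' := hB.differentiableAt (by simp)
  have hf' := hf.differentiableAt (by simp)
  have hAvw : DifferentiableAt ℝ (fun y ↦ A y v.1 w.1) p.1 :=
    (hA'.clm_apply (differentiableAt_const _)).clm_apply (differentiableAt_const _)
  have hBvw : DifferentiableAt ℝ (fun y ↦ B y v.2 w.2) p.2 :=
    (hB'.clm_apply (differentiableAt_const _)).clm_apply (differentiableAt_const _)
  have h1 : DifferentiableAt ℝ (fun z : E × E' ↦ A z.1 v.1 w.1) p :=
    DifferentiableAt.comp p hAvw differentiableAt_fst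
  have h2 : DifferentiableAt ℝ (fun z : E × E' ↦ B z.2 v.2 w.2) p :=
    DifferentiableAt.comp p hBvw differentiableAt_snd
  have h3 : DifferentiableAt ℝ (fun z : E × E' ↦ f z.1) p :=
    DifferentiableAt.comp p hf' differentiableAt_fst
  rw [← fderiv_apply_apply ((contDiffAt_warpedForm (by simp) hA hf hB).differentiableAt (by simp))]
  simp only [warpedForm_apply]
  rw [fderiv_fun_add h1 ((h3.fun_pow 2).fun_mul h2), fderiv_fun_mul (h3.fun_pow 2) h2,
    fderiv_fun_pow 2 h3]
  simp only [add_apply, smul_apply, smul_eq_mul]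
  rw [fderiv_comp_fst_apply hAvw, fderiv_comp_fst_apply hf', fderiv_comp_snd_apply hBvw,
    fderiv_apply_apply hA', fderiv_apply_apply hB']
  simp
  ring

theorem apply_coordGrad {y : E} (hA : (A y).IsInvertible) (v : E) :
    A y (coordGrad A f y) v = fderiv ℝ f y v := by
  rw [coordGrad, hA.self_apply_inverse]

variable [FiniteDimensional ℝ E] [FiniteDimensional ℝ E']

theorem contDiffAt_coordGrad {y : E} (hA : ContDiffAt ℝ ∞ A y) (hAi : (A y).IsInvertible)
    (hf : ContDiffAt ℝ ∞ f y) : ContDiffAt ℝ ∞ (coordGrad A f) y :=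
  (contDiffAt_inverse hA hAi).clm_apply (hf.fderiv_right (m := ∞) (by simp))

/-- In the Koszul formula the derivative of f² contributes three terms. The one differentiating
along w is paired through A and gives the gradient term; the other two are paired through f² B and
give the factors df / f. The hypotheses are only C¹ so that the formula can be used at points near a
given one: smoothness of order ∞ at a point provides, for each finite k, a neighbourhood of C^k
regularity. -/
theorem christoffel_warpedForm (hA : ContDiffAt ℝ 1 A p.1) (hf : ContDiffAt ℝ 1 f p.1)
    (hB : ContDiffAt ℝ 1 B p.2) (hAi : (A p.1).IsInvertible) (hf0 : f p.1 ≠ 0)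
    (hBi : (B p.2).IsInvertible) (hBs : ∀ z u v, B z u v = B z v u) (u v : E × E') :
    christoffel (warpedForm A f B) p u v =
      (christoffel A p.1 u.1 v.1 - (f p.1 * B p.2 u.2 v.2) • coordGrad A f p.1,
        christoffel B p.2 u.2 v.2 +
          ((fderiv ℝ f p.1 u.1 / f p.1) • v.2 + (fderiv ℝ f p.1 v.1 / f p.1) • u.2)) := by
  refine christoffel_eq (isInvertible_warpedForm hAi hf0 hBi) fun w ↦ ?_
  rw [christoffelLower_apply ((contDiffAt_warpedForm (by simp) hA hf hB).differentiableAt (by simp)),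
    warpedForm_apply]
  simp only [fderiv_warpedForm hA hf hB, bilin_sub_left, bilin_add_left, bilin_smul_left,
    apply_coordGrad hAi, apply_christoffel hAi, apply_christoffel hBi]
  rw [christoffelLower_apply (hA.differentiableAt (by simp)),
    christoffelLower_apply (hB.differentiableAt (by simp)), hBs _ u.2 w.2]
  field_simp
  ring

theorem fderiv_christoffel_warpedForm (hA : ContDiffAt ℝ ∞ A p.1) (hf : ContDiffAt ℝ ∞ f p.1)
    (hB : ContDiffAt ℝ ∞ B p.2) (hAi : (A p.1).IsInvertible) (hf0 : f p.1 ≠ 0)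
    (hBi : (B p.2).IsInvertible) (hBs : ∀ z u v, B z u v = B z v u) (u v w : E × E') :
    fderiv ℝ (fun z ↦ christoffel (warpedForm A f B) z v w) p u =
      (fderiv ℝ (fun z ↦ christoffel A z v.1 w.1) p.1 u.1 -
          ((f p.1 * B p.2 v.2 w.2) • fderiv ℝ (coordGrad A f) p.1 u.1 +
          (fderiv ℝ f p.1 u.1 * B p.2 v.2 w.2 + f p.1 * fderiv ℝ B p.2 u.2 v.2 w.2) •
            coordGrad A f p.1),
        fderiv ℝ (fun z ↦ christoffel B z v.2 w.2) p.2 u.2 +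
          ((fderiv ℝ (fderiv ℝ f) p.1 u.1 v.1 / f p.1 -
              fderiv ℝ f p.1 v.1 * fderiv ℝ f p.1 u.1 / f p.1 ^ 2) • w.2 +
            (fderiv ℝ (fderiv ℝ f) p.1 u.1 w.1 / f p.1 -
              fderiv ℝ f p.1 w.1 * fderiv ℝ f p.1 u.1 / f p.1 ^ 2) • v.2)) := by
  have hev : (fun z ↦ christoffel (warpedForm A f B) z v w) =ᶠ[nhds p] fun z : E × E' ↦
      (christoffel A z.1 v.1 w.1 - (f z.1 * B z.2 v.2 w.2) • coordGrad A f z.1,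
        christoffel B z.2 v.2 w.2 +
          ((fderiv ℝ f z.1 v.1 / f z.1) • w.2 + (fderiv ℝ f z.1 w.1 / f z.1) • v.2)) := by
    have hA1 := continuousAt_fst.eventually
      (((hA.of_le (m := 1) (by simp)).eventually (by simp)).and (eventually_isInvertible hA.continuousAt hAi))
    have hB1 := continuousAt_snd.eventually
      (((hB.of_le (m := 1) (by simp)).eventually (by simp)).and (eventually_isInvertible hB.continuousAt hBi))
    have hf1 := continuousAt_fst.eventually
      (((hf.of_le (m := 1) (by simp)).eventually (by simp)).and (hf.continuousAt.eventually_ne hf0))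
    filter_upwards [hA1, hB1, hf1] with z hzA hzB hzf
    exact christoffel_warpedForm hzA.1 hzf.1 hzB.1 hzA.2 hzf.2 hzB.2 hBs v w
  rw [hev.fderiv_eq]
  have hB' := hB.differentiableAt (by simp)
  have hf' := hf.differentiableAt (by simp)
  have hN := (contDiffAt_coordGrad hA hAi hf).differentiableAt (by simp)
  have hΓA := differentiableAt_christoffel hA hAi v.1 w.1
  have hΓB := differentiableAt_christoffel hB hBi v.2 w.2
  have hBvw : DifferentiableAt ℝ (fun y ↦ B y v.2 w.2) p.2 :=
    (hB'.clm_apply (differentiableAt_const _)).clm_apply (differentiableAt_const _)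
  -- Quotient rule for the coefficients df(x) / f of the vertical component.
  have hq : ∀ x : E, HasFDerivAt (fun y ↦ fderiv ℝ f y x / f y)
      ((f p.1)⁻¹ • fderiv ℝ (fun y ↦ fderiv ℝ f y x) p.1 -
        (fderiv ℝ f p.1 x / f p.1 ^ 2) • fderiv ℝ f p.1) p.1 := by
    intro x
    have hx := ((contDiffAt_fderiv_apply hf x).differentiableAt (by simp)).hasFDerivAt
    have hinv := (hasDerivAt_inv hf0).comp_hasFDerivAt p.1 hf'.hasFDerivAt
    refine (hx.mul hinv).congr_fderiv ?_
    ext t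
    simp
    field_simp
    ring
  have d1 := (hΓA.hasFDerivAt.comp p hasFDerivAt_fst).sub
    (((hf'.hasFDerivAt.comp p hasFDerivAt_fst).mul
      (hBvw.hasFDerivAt.comp p hasFDerivAt_snd)).smul (hN.hasFDerivAt.comp p hasFDerivAt_fst))
  have d2 := (hΓB.hasFDerivAt.comp p hasFDerivAt_snd).add
    ((((hq v.1).comp p hasFDerivAt_fst).smul_const w.2).add
      (((hq w.1).comp p hasFDerivAt_fst).smul_const v.2))
  refine (congrArg (fun L ↦ L u) (d1.prodMk d2).fderiv).trans ?_
  simp [fderiv_apply_apply hB', fderiv_fderiv_apply hf]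
  exact ⟨by congr 1; ring, by congr 2 <;> ring⟩

end WarpedCoordinates

/-! ### Ricci tensor and Hessian of a warped product -/

section WarpedCurvature

variable {E : Type*} [NormedAddCommGroup E] [NormedSpace ℝ E]
  {E' : Type*} [NormedAddCommGroup E'] [NormedSpace ℝ E']
  {A : E → E →L[ℝ] E →L[ℝ] ℝ} {f : E → ℝ} {B : E' → E' →L[ℝ] E' →L[ℝ] ℝ} {p : E × E'}
  [FiniteDimensional ℝ E] [FiniteDimensional ℝ E']

/-- For the trace, only the horizontal component of R(u, v) w with u horizontal is needed, and
likewise for vertical u. -/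
theorem coordCurvature_warpedForm_fst
    (hA : ContDiffAt ℝ ∞ A p.1) (hf : ContDiffAt ℝ ∞ f p.1)
    (hB : ContDiffAt ℝ ∞ B p.2) (hAi : (A p.1).IsInvertible) (hf0 : f p.1 ≠ 0)
    (hBi : (B p.2).IsInvertible) (hBs : ∀ z u v, B z u v = B z v u) (u : E) (v w : E × E') :
    (coordCurvature (warpedForm A f B) p (u, 0) v w).1 =
      coordCurvature A p.1 u v.1 w.1 -
        (f p.1 * B p.2 v.2 w.2) • coordDerivGrad A f p.1 u := by
  have hdA := hA.differentiableAt (by simp)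
  have hdB := hB.differentiableAt (by simp)
  have h0 : ∀ a b, fderiv ℝ B p.2 0 a b = 0 := fun a b ↦ by
    rw [ContinuousLinearMap.map_zero (fderiv ℝ B p.2)]
    rfl
  have h1 : ∀ b, B p.2 0 b = 0 := fun b ↦ by simp
  have h2 : ∀ a b, fderiv ℝ B p.2 a 0 b = 0 := fun a b ↦ by simp
  have h3 : ∀ a (c : ℝ) b, B p.2 a (c • b) = c * B p.2 a b :=
    fun a c b ↦ by simp
  simp only [coordCurvature, fderiv_christoffel_warpedForm hA hf hB hAi hf0 hBi hBs,
    christoffel_warpedForm (hA.of_le (by simp)) (hf.of_le (by simp)) (hB.of_le (by simp)) hAi hf0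
      hBi hBs, Prod.fst_add, Prod.fst_sub, h0, h1, h2, christoffel_zero_left hdB,
      christoffel_sub_right hdA, christoffel_smul_right hdA, coordDerivGrad, smul_zero, add_zero,
      zero_add, mul_zero, zero_smul, sub_zero, h3]
  -- This term comes from Γ(v, Γ(u, w)). It cancels the derivative of the factor f in f B(v, w) ∇f,
  -- so that only f B(v, w) ∇_u ∇f remains.
  have hc : f p.1 * (fderiv ℝ f p.1 u / f p.1 * B p.2 v.2 w.2) = fderiv ℝ f p.1 u * B p.2 v.2 w.2 := by
    field_simp
  rw [hc]
  module

theorem coordCurvature_warpedForm_snd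
    (hA : ContDiffAt ℝ ∞ A p.1) (hf : ContDiffAt ℝ ∞ f p.1)
    (hB : ContDiffAt ℝ ∞ B p.2) (hAi : (A p.1).IsInvertible) (hf0 : f p.1 ≠ 0)
    (hBi : (B p.2).IsInvertible) (hBs : ∀ z u v, B z u v = B z v u) (u : E') (v w : E × E') :
    (coordCurvature (warpedForm A f B) p (0, u) v w).2 =
      coordCurvature B p.2 u v.2 w.2 - (coordHess A f p.1 v.1 w.1 / f p.1) • u -
        fderiv ℝ f p.1 (coordGrad A f p.1) • (B p.2 v.2 w.2 • u - B p.2 u w.2 • v.2) := by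
  have hdA := hA.differentiableAt (by simp)
  have hdB := hB.differentiableAt (by simp)
  simp only [coordCurvature, fderiv_christoffel_warpedForm hA hf hB hAi hf0 hBi hBs,
    christoffel_warpedForm (hA.of_le (by simp)) (hf.of_le (by simp)) (hB.of_le (by simp)) hAi hf0
      hBi hBs, Prod.snd_add, Prod.snd_sub, christoffel_zero_left hdA,
      christoffel_add_right hdB, christoffel_smul_right hdB, coordHess, smul_zero, add_zero,
      zero_add, mul_zero, zero_smul, sub_zero, map_sub, map_zero, map_smul, smul_eq_mul, zero_apply,
      zero_div, zero_mul, fderiv_fderiv_apply hf, zero_sub, map_neg]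
  -- The products df(w) / f · Γ_B occur with the arguments u, v in both orders; torsion-freeness
  -- cancels them.
  rw [christoffel_comm hdB hBs v.2 u]
  match_scalars <;> field_simp <;> ring

/-- The horizontal block contributes Ric_A and -f B Δf. In the vertical block, the identity has
trace m and u ↦ B(u, w) v has trace B(v, w), whence the coefficient m - 1 of |∇f|². -/
theorem coordRicci_warpedForm
    (hA : ContDiffAt ℝ ∞ A p.1) (hf : ContDiffAt ℝ ∞ f p.1)
    (hB : ContDiffAt ℝ ∞ B p.2) (hAi : (A p.1).IsInvertible) (hf0 : f p.1 ≠ 0)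
    (hBi : (B p.2).IsInvertible) (hBs : ∀ z u v, B z u v = B z v u) (v w : E × E') :
    coordRicci (warpedForm A f B) p v w =
      coordRicci A p.1 v.1 w.1 - Module.finrank ℝ E' / f p.1 * coordHess A f p.1 v.1 w.1 +
      (coordRicci B p.2 v.2 w.2 - (f p.1 * coordLaplacian A f p.1 +
        (Module.finrank ℝ E' - 1) * fderiv ℝ f p.1 (coordGrad A f p.1)) * B p.2 v.2 w.2) := by
  rw [coordRicci_eq_sum ((Module.finBasis ℝ E).prod (Module.finBasis ℝ E'))
    (contDiffAt_warpedForm le_rfl hA hf hB) (isInvertible_warpedForm hAi hf0 hBi),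
    Fintype.sum_sum_type]
  simp only [Module.Basis.prod_repr_inl, Module.Basis.prod_repr_inr,
    Module.Basis.prod_apply, Sum.elim_inl, Sum.elim_inr, Function.comp_apply, LinearMap.inl_apply,
    LinearMap.inr_apply, coordCurvature_warpedForm_fst hA hf hB hAi hf0 hBi hBs,
    coordCurvature_warpedForm_snd hA hf hB hAi hf0 hBi hBs, map_sub, map_smul, Finsupp.sub_apply,
    Finsupp.smul_apply, Finset.sum_sub_distrib, smul_eq_mul, ← Finset.mul_sum, sum_repr_self]
  rw [← coordRicci, ← coordRicci, ← coordLaplacian]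
  have h := sum_repr_smul (Module.finBasis ℝ E')
    ((B p.2).flip w.2 : E' →ₗ[ℝ] ℝ) v.2
  simp only [ContinuousLinearMap.coe_coe, ContinuousLinearMap.flip_apply] at h
  rw [h]
  ring

/-- As h is constant along the fibres, only the horizontal component of the Christoffel symbols acts
on it; its gradient term gives the vertical part. -/
theorem coordHess_warpedForm {h : E → ℝ}
    (hA : ContDiffAt ℝ ∞ A p.1) (hf : ContDiffAt ℝ ∞ f p.1)
    (hB : ContDiffAt ℝ ∞ B p.2) (hAi : (A p.1).IsInvertible) (hf0 : f p.1 ≠ 0)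
    (hBi : (B p.2).IsInvertible) (hBs : ∀ z u v, B z u v = B z v u)
    (hh : ContDiffAt ℝ ∞ h p.1) (v w : E × E') :
    coordHess (warpedForm A f B) (fun z ↦ h z.1) p v w =
      coordHess A h p.1 v.1 w.1 +
        f p.1 * fderiv ℝ h p.1 (coordGrad A f p.1) * B p.2 v.2 w.2 := by
  have h1 : (fun z : E × E' ↦ fderiv ℝ (fun z : E × E' ↦ h z.1) z w) =ᶠ[nhds p]
      fun z ↦ fderiv ℝ h z.1 w.1 := by
    filter_upwards [continuousAt_fst.eventually (eventually_differentiableAt hh)] with z hz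
    exact fderiv_comp_fst_apply hz w
  rw [coordHess, h1.fderiv_eq, 
    fderiv_comp_fst_apply (g := fun y ↦ fderiv ℝ h y w.1) ((contDiffAt_fderiv_apply hh w.1).differentiableAt (by simp)),
    fderiv_comp_fst_apply (hh.differentiableAt (by simp)),
    christoffel_warpedForm (hA.of_le (by simp)) (hf.of_le (by simp)) (hB.of_le (by simp)) hAi hf0
      hBi hBs, coordHess, map_sub, map_smul, smul_eq_mul]
  ring

end WarpedCurvature

/-! ### From tensors on a manifold to forms in a chart -/

section MetricInChart

variable {E : Type*} [NormedAddCommGroup E] [NormedSpace ℝ E]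
  {H : Type*} [TopologicalSpace H] {I : ModelWithCorners ℝ E H}
  {M : Type*} [TopologicalSpace M] [ChartedSpace H M] [IsManifold I ∞ M]

theorem surjective_mfderiv_extChartAt (p : M) :
    Function.Surjective (mfderiv I 𝓘(ℝ, E) (extChartAt I p) p) := by
  have : IsManifold I 1 M := IsManifold.of_le (n := ∞) (by simp)
  exact (isInvertible_mfderiv_extChartAt (mem_extChartAt_source p)).surjective

/-- An equation between bilinear forms on the tangent space at `p` may be checked in the chart
around `p`. -/
theorem forall_mfderiv_extChartAt_iff (p : M) (P : E → E → Prop) :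
    (∀ u v : TangentSpace I p, P (mfderiv I 𝓘(ℝ, E) (extChartAt I p) p u)
      (mfderiv I 𝓘(ℝ, E) (extChartAt I p) p v)) ↔ ∀ a b, P a b := by
  refine ⟨fun h a b ↦ ?_, fun h u v ↦ h _ _⟩
  obtain ⟨u, rfl⟩ := surjective_mfderiv_extChartAt (I := I) p a
  obtain ⟨v, rfl⟩ := surjective_mfderiv_extChartAt (I := I) p b
  exact h u v

variable [I.Boundaryless]

namespace SemiRiemannianMetric

theorem inChart_symm (g : SemiRiemannianMetric I M) (p : M) (y u v : E) :
    g.inChart p y u v = g.inChart p y v u :=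
  g.symm ((extChartAt I p).symm y) (mfderiv 𝓘(ℝ, E) I (extChartAt I p).symm y u)
    (mfderiv 𝓘(ℝ, E) I (extChartAt I p).symm y v)

/-- Smoothness of the metric is known in the trivialization of the tangent bundle, whereas `inChart`
uses the derivative of the inverse chart. The two agree on the target of the chart. -/
theorem inChart_eq_bilinearComp_symmL (g : SemiRiemannianMetric I M) (p : M) {y : E}
    (hy : y ∈ (extChartAt I p).target) :
    g.inChart p y =
      let A : E →L[ℝ] E := (trivializationAt E (TangentSpace I) p).symmL ℝ ((extChartAt I p).symm y)
      let B : E →L[ℝ] E →L[ℝ] ℝ := g.inner ((extChartAt I p).symm y)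
      B.bilinearComp A A := by
  have : IsManifold I 1 M := IsManifold.of_le (n := ∞) (by simp)
  have hs : (extChartAt I p).symm y ∈ (chartAt H p).source := by
    rw [← extChartAt_source (I := I)]
    exact (extChartAt I p).map_target hy
  -- The points are only propositionally equal and occur in the types of the derivatives, so the
  -- equality is transported by substitution.
  have key : ∀ y', y' = y → (mfderiv 𝓘(ℝ, E) I (extChartAt I p).symm y' : E →L[ℝ] E) =
      (mfderiv 𝓘(ℝ, E) I (extChartAt I p).symm y : E →L[ℝ] E) := by
    rintro _ rfl
    rfl
  have h := key _ ((extChartAt I p).right_inv hy)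
  have h2 := TangentBundle.symmL_trivializationAt (𝕜 := ℝ) (I := I) hs
  rw [I.range_eq_univ, mfderivWithin_univ] at h2
  have h3 : ((trivializationAt E (TangentSpace I) p).symmL ℝ ((extChartAt I p).symm y) :
      E →L[ℝ] E) = (mfderiv 𝓘(ℝ, E) I (extChartAt I p).symm y : E →L[ℝ] E) := h2.trans h
  simp only [inChart]
  rw [h3]

theorem contDiffAt_inChart (g : SemiRiemannianMetric I M) (p : M) :
    ContDiffAt ℝ ∞ (g.inChart p) (extChartAt I p p) := by
  have h1 := (contMDiffAt_bilinForm_iff _ _).1 (g.contMDiff p)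
  have h2 : ContMDiffAt 𝓘(ℝ, E) I ∞ (extChartAt I p).symm (extChartAt I p p) :=
    (contMDiffOn_extChartAt_symm p).contMDiffAt (extChartAt_target_mem_nhds p)
  have h3 := ContMDiffAt.comp_of_eq h1 h2 (extChartAt_to_inv p)
  refine (contMDiffAt_iff_contDiffAt.1 h3).congr_of_eventuallyEq ?_
  filter_upwards [extChartAt_target_mem_nhds (I := I) p] with y hy
  exact g.inChart_eq_bilinearComp_symmL p hy

theorem inChart_mfderiv_apply (g : SemiRiemannianMetric I M) (p : M) (u v : TangentSpace I p) :
    g.inChart p (extChartAt I p p) (mfderiv I 𝓘(ℝ, E) (extChartAt I p) p u)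
      (mfderiv I 𝓘(ℝ, E) (extChartAt I p) p v) = g.inner p u v := by
  have : IsManifold I 1 M := IsManifold.of_le (n := ∞) (by simp)
  have h := mfderivWithin_extChartAt_symm_comp_mfderiv_extChartAt' (I := I)
    (mem_extChartAt_source (I := I) p)
  rw [I.range_eq_univ, mfderivWithin_univ] at h
  have h' : ∀ w : TangentSpace I p, (mfderiv 𝓘(ℝ, E) I (extChartAt I p).symm (extChartAt I p p) :
      E →L[ℝ] E) (mfderiv I 𝓘(ℝ, E) (extChartAt I p) p w) = w :=
    fun w ↦ congrArg (fun L : E →L[ℝ] E ↦ L w) h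
  have key : ∀ q, q = p → ∀ a b : E, (g.inner q : E →L[ℝ] E →L[ℝ] ℝ) a b =
      (g.inner p : E →L[ℝ] E →L[ℝ] ℝ) a b := by
    rintro _ rfl a b
    rfl
  exact (key _ (extChartAt_to_inv p) _ _).trans (congrArg₂
    (fun a b : E ↦ (g.inner p : E →L[ℝ] E →L[ℝ] ℝ) a b) (h' u) (h' v))

theorem isInvertible_inChart [FiniteDimensional ℝ E] (g : SemiRiemannianMetric I M) (p : M) :
    (g.inChart p (extChartAt I p p)).IsInvertible := by
  refine isInvertible_of_nondegenerate _ fun a ha ↦ ?_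
  obtain ⟨u, rfl⟩ := surjective_mfderiv_extChartAt (I := I) p a
  have : u = 0 := g.nondegenerate p u fun v ↦ by rw [← g.inChart_mfderiv_apply p u v]; exact ha _
  rw [this]
  exact map_zero _

theorem ricci_eq_iff [FiniteDimensional ℝ E] (g : SemiRiemannianMetric I M) (p : M) (c : ℝ) :
    (∀ u v : TangentSpace I p, g.ricci p u v = c * g.inner p u v) ↔
      ∀ a b : E, coordRicci (g.inChart p) (extChartAt I p p) a b =
        c * g.inChart p (extChartAt I p p) a b := by
  rw [← forall_mfderiv_extChartAt_iff (I := I) p]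
  simp only [inChart_mfderiv_apply]
  rfl

theorem ricci_add_hess_eq_iff [FiniteDimensional ℝ E] (g : SemiRiemannianMetric I M) (h : M → ℝ)
    (p : M) (c : ℝ) :
    (∀ u v : TangentSpace I p, g.ricci p u v + g.hess h p u v = c * g.inner p u v) ↔
      ∀ a b : E, coordRicci (g.inChart p) (extChartAt I p p) a b +
        coordHess (g.inChart p) (h ∘ (extChartAt I p).symm) (extChartAt I p p) a b =
        c * g.inChart p (extChartAt I p p) a b := by
  rw [← forall_mfderiv_extChartAt_iff (I := I) p]
  simp only [inChart_mfderiv_apply]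
  rfl

end SemiRiemannianMetric

variable {E' : Type*} [NormedAddCommGroup E'] [NormedSpace ℝ E']
  {H' : Type*} [TopologicalSpace H'] {I' : ModelWithCorners ℝ E' H'} [I'.Boundaryless]
  {M' : Type*} [TopologicalSpace M'] [ChartedSpace H' M'] [IsManifold I' ∞ M']

/-- Charts of the product are products of charts, so the tangent trivialization is block diagonal.
Agreement near the base point is all that curvature and Hessian require. -/
theorem inChart_warpedProduct (g : SemiRiemannianMetric I M) (f : M → ℝ)
    (hf : ContMDiff I 𝓘(ℝ, ℝ) ∞ f) (hpos : ∀ x, 0 < f x) (g' : SemiRiemannianMetric I' M')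
    (p : M × M') :
    (warpedProduct g f hf hpos g').inChart p =ᶠ[nhds (extChartAt (I.prod I') p p)]
      warpedForm (g.inChart p.1) (f ∘ (extChartAt I p.1).symm) (g'.inChart p.2) := by
  filter_upwards [extChartAt_target_mem_nhds (I := I.prod I') p] with y hy
  have hy' : y.1 ∈ (extChartAt I p.1).target ∧ y.2 ∈ (extChartAt I' p.2).target := by
    rw [extChartAt_prod] at hy
    exact hy
  have hs : (extChartAt (I.prod I') p).symm y ∈ (chartAt (ModelProd H H') p).source := by
    rw [← extChartAt_source (I := I.prod I')]
    exact (extChartAt (I.prod I') p).map_target hy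
  rw [SemiRiemannianMetric.inChart_eq_bilinearComp_symmL _ p hy,
    warpedForm, g.inChart_eq_bilinearComp_symmL p.1 hy'.1,
    g'.inChart_eq_bilinearComp_symmL p.2 hy'.2]
  simp only []
  rw [symmL_trivializationAt_prod hs]
  rfl

end MetricInChart

/-! ### Metrics conformal to a constant form -/

section ConformalCoordinates

variable {E : Type*} [NormedAddCommGroup E] [NormedSpace ℝ E]

/-- The field of bilinear forms `q / φ ^ 2` conformal to the constant form `q`. -/
def conformalForm (q : E →L[ℝ] E →L[ℝ] ℝ) (φ : E → ℝ) (y : E) : E →L[ℝ] E →L[ℝ] ℝ :=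
  (1 / φ y ^ 2) • q

/-- The d'Alembertian of a function with respect to the constant form `q`. -/
def dAlembertian [FiniteDimensional ℝ E] (q : E →L[ℝ] E →L[ℝ] ℝ) (f : E → ℝ) (y : E) : ℝ :=
  ∑ i, (Module.finBasis ℝ E).repr
    (q.inverse (fderiv ℝ (fderiv ℝ f) y (Module.finBasis ℝ E i))) i

variable {q : E →L[ℝ] E →L[ℝ] ℝ} {φ f : E → ℝ}

theorem conformalForm_apply (y u v : E) : conformalForm q φ y u v = 1 / φ y ^ 2 * q u v :=
  rfl

theorem contDiff_conformalForm (hφ : ContDiff ℝ ∞ φ) (hφ0 : ∀ y, φ y ≠ 0) :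
    ContDiff ℝ ∞ (conformalForm q φ) :=
  contDiff_smul_const' (contDiff_const.div (hφ.pow 2) (by simp [hφ0])) q

theorem isInvertible_conformalForm [FiniteDimensional ℝ E] (hq : q.IsInvertible) {y : E}
    (hφ0 : φ y ≠ 0) : (conformalForm q φ y).IsInvertible := by
  refine isInvertible_of_nondegenerate _ fun u hu ↦ hq.injective ?_
  ext v
  have := hu v
  rw [conformalForm_apply] at this
  simpa [hφ0] using this

theorem fderiv_conformalForm (hφ : ContDiff ℝ ∞ φ) (hφ0 : ∀ y, φ y ≠ 0) (y u v w : E) :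
    fderiv ℝ (conformalForm q φ) y u v w = -2 * fderiv ℝ φ y u / φ y ^ 3 * q v w := by
  rw [← fderiv_apply_apply ((contDiff_conformalForm hφ hφ0).differentiable (by simp) y)]
  simp only [conformalForm_apply]
  have hd := (hφ.differentiable (by simp) y).hasFDerivAt
  have h1 := (hasDerivAt_inv (pow_ne_zero 2 (hφ0 y))).comp_hasFDerivAt y (hd.pow 2)
  have h2 := h1.mul_const (q v w)
  simp only [one_div]
  refine (congrArg (fun L ↦ L u) h2.fderiv).trans ?_
  have := hφ0 y
  simp
  field_simp

theorem apply_inverse (hq : q.IsInvertible) (L : E →L[ℝ] ℝ) (v : E) : q (q.inverse L) v = L v := by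
  rw [hq.self_apply_inverse]

theorem hasFDerivAt_inverse_fderiv (q : E →L[ℝ] E →L[ℝ] ℝ) (hf : ContDiff ℝ ∞ f) (y : E) :
    HasFDerivAt (fun z ↦ q.inverse (fderiv ℝ f z)) (q.inverse ∘L fderiv ℝ (fderiv ℝ f) y) y :=
  q.inverse.hasFDerivAt.comp y
    (((hf.fderiv_right (m := ∞) (by simp)).differentiable (by simp)) y).hasFDerivAt

variable [FiniteDimensional ℝ E]

/-- The form q is constant, so only the derivative -2 dφ / φ³ of the conformal factor enters the
Koszul formula. -/
theorem christoffel_conformalForm (hq : q.IsInvertible)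
    (hφ : ContDiff ℝ ∞ φ) (hφ0 : ∀ y, φ y ≠ 0) (y u v : E) :
    christoffel (conformalForm q φ) y u v =
      (φ y)⁻¹ • (q u v • q.inverse (fderiv ℝ φ y) - fderiv ℝ φ y u • v - fderiv ℝ φ y v • u) := by
  refine christoffel_eq (isInvertible_conformalForm hq (hφ0 y)) fun w ↦ ?_
  rw [christoffelLower_apply ((contDiff_conformalForm hφ hφ0).differentiable (by simp) y)]
  simp only [fderiv_conformalForm hφ hφ0, conformalForm_apply, bilin_smul_left, bilin_sub_left,
    apply_inverse hq]
  have := hφ0 y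
  field_simp
  ring

theorem coordGrad_conformalForm (hq : q.IsInvertible) (hφ0 : ∀ y, φ y ≠ 0) (y : E) :
    coordGrad (conformalForm q φ) f y = φ y ^ 2 • q.inverse (fderiv ℝ f y) := by
  refine (isInvertible_conformalForm (φ := φ) hq (hφ0 y)).injective (ContinuousLinearMap.ext fun w ↦ ?_)
  rw [apply_coordGrad (isInvertible_conformalForm hq (hφ0 y)), conformalForm_apply,
    bilin_smul_left, apply_inverse hq]
  have := hφ0 y
  field_simp

theorem coordHess_conformalForm (hq : q.IsInvertible)
    (hφ : ContDiff ℝ ∞ φ) (hφ0 : ∀ y, φ y ≠ 0) (hf : ContDiff ℝ ∞ f) (y u v : E) :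
    coordHess (conformalForm q φ) f y u v = fderiv ℝ (fderiv ℝ f) y u v +
      (φ y)⁻¹ * (fderiv ℝ φ y u * fderiv ℝ f y v + fderiv ℝ φ y v * fderiv ℝ f y u -
        q u v * fderiv ℝ f y (q.inverse (fderiv ℝ φ y))) := by
  rw [coordHess, fderiv_fderiv_apply hf.contDiffAt, christoffel_conformalForm hq hφ hφ0]
  simp only [map_smul, map_sub, smul_eq_mul]
  ring

theorem fderiv_christoffel_conformalForm (hq : q.IsInvertible)
    (hφ : ContDiff ℝ ∞ φ) (hφ0 : ∀ y, φ y ≠ 0) (y u v w : E) :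
    fderiv ℝ (fun z ↦ christoffel (conformalForm q φ) z v w) y u =
      (φ y)⁻¹ • (q v w • q.inverse (fderiv ℝ (fderiv ℝ φ) y u) -
        fderiv ℝ (fderiv ℝ φ) y u v • w - fderiv ℝ (fderiv ℝ φ) y u w • v) -
      (fderiv ℝ φ y u / φ y ^ 2) • (q v w • q.inverse (fderiv ℝ φ y) - fderiv ℝ φ y v • w -
        fderiv ℝ φ y w • v) := by
  simp only [christoffel_conformalForm hq hφ hφ0]
  have hd := (hφ.differentiable (by simp) y).hasFDerivAt
  have h0 := (hasDerivAt_inv (hφ0 y)).comp_hasFDerivAt y hd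
  have hx : ∀ x, HasFDerivAt (fun z ↦ fderiv ℝ φ z x) (fderiv ℝ (fun z ↦ fderiv ℝ φ z x) y) y :=
    fun x ↦ ((contDiffAt_fderiv_apply hφ.contDiffAt x).differentiableAt (by simp)).hasFDerivAt
  have h1 := h0.smul ((((hasFDerivAt_inverse_fderiv q hφ y).const_smul (q v w)).sub
    ((hx v).smul_const w)).sub ((hx w).smul_const v))
  refine (congrArg (fun L ↦ L u) h1.fderiv).trans ?_
  simp [fderiv_fderiv_apply hφ.contDiffAt]
  module

/-- With the factor written as φ⁻², the dφ ⊗ dφ terms cancel: second derivatives of φ enter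
linearly, and first derivatives only through |dφ|². -/
theorem coordCurvature_conformalForm (hq : q.IsInvertible) (hs : ∀ u v, q u v = q v u)
    (hφ : ContDiff ℝ ∞ φ) (hφ0 : ∀ y, φ y ≠ 0) (y u v w : E) :
    coordCurvature (conformalForm q φ) y u v w =
      (φ y)⁻¹ • (fderiv ℝ (fderiv ℝ φ) y v w • u - fderiv ℝ (fderiv ℝ φ) y u w • v +
        q v w • q.inverse (fderiv ℝ (fderiv ℝ φ) y u) -
        q u w • q.inverse (fderiv ℝ (fderiv ℝ φ) y v)) -
      (fderiv ℝ φ y (q.inverse (fderiv ℝ φ y)) / φ y ^ 2) • (q v w • u - q u w • v) := by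
  have hP : ∀ x, q x (q.inverse (fderiv ℝ φ y)) = fderiv ℝ φ y x := fun x ↦ by
    rw [hs, apply_inverse hq]
  have hm : ∀ x (c : ℝ) z, q x (c • z) = c * q x z := fun x c z ↦
    ContinuousLinearMap.map_smul (q x) c z
  have hb : ∀ x z z', q x (z - z') = q x z - q x z' := fun x z z' ↦
    ContinuousLinearMap.map_sub (q x) z z'
  simp only [coordCurvature, fderiv_christoffel_conformalForm hq hφ hφ0]
  simp only [christoffel_conformalForm hq hφ hφ0, hm, hb, hP, map_smul, map_sub, smul_eq_mul]
  rw [fderiv_fderiv_comm hφ.contDiffAt v u, hs v u]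
  have := hφ0 y
  match_scalars <;> field_simp <;> ring

/-- Of the four Hessian terms of the curvature, the traces are n, -1 and -1 times D²φ(v, w),
together with q(v, w) times the d'Alembertian; hence n - 2. -/
theorem coordRicci_conformalForm (hq : q.IsInvertible) (hs : ∀ u v, q u v = q v u)
    (hφ : ContDiff ℝ ∞ φ) (hφ0 : ∀ y, φ y ≠ 0) (y v w : E) :
    coordRicci (conformalForm q φ) y v w =
      (Module.finrank ℝ E - 2) * (φ y)⁻¹ * fderiv ℝ (fderiv ℝ φ) y v w +
      q v w * ((φ y)⁻¹ * dAlembertian q φ y - (Module.finrank ℝ E - 1) *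
        (fderiv ℝ φ y (q.inverse (fderiv ℝ φ y)) / φ y ^ 2)) := by
  have h1 : ∀ z, ∑ i, q (Module.finBasis ℝ E i) w * (Module.finBasis ℝ E).repr z i = q z w :=
    fun z ↦ sum_repr_smul (Module.finBasis ℝ E) (q.flip w : E →ₗ[ℝ] ℝ) z
  have h2 : ∑ i, fderiv ℝ (fderiv ℝ φ) y (Module.finBasis ℝ E i) w *
      (Module.finBasis ℝ E).repr v i = fderiv ℝ (fderiv ℝ φ) y v w :=
    sum_repr_smul (Module.finBasis ℝ E) ((fderiv ℝ (fderiv ℝ φ) y).flip w : E →ₗ[ℝ] ℝ) v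
  simp only [coordRicci, coordCurvature_conformalForm hq hs hφ hφ0, map_sub, map_add, map_smul,
    Finsupp.sub_apply, Finsupp.add_apply, Finsupp.smul_apply, Finset.sum_sub_distrib,
    Finset.sum_add_distrib, smul_eq_mul, ← Finset.mul_sum, sum_repr_self, h1, h2,
    apply_inverse hq]
  rw [← dAlembertian]
  ring

/-- Two rank-one terms of ∇_u ∇f each have trace φ ⟨df, dφ⟩, and the multiple of the identity has
trace -n times this; hence -(n - 2). -/
theorem coordLaplacian_conformalForm (hq : q.IsInvertible) (hs : ∀ u v, q u v = q v u)
    (hφ : ContDiff ℝ ∞ φ) (hφ0 : ∀ y, φ y ≠ 0) (hf : ContDiff ℝ ∞ f) (y : E) :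
    coordLaplacian (conformalForm q φ) f y = φ y ^ 2 * dAlembertian q f y -
      (Module.finrank ℝ E - 2) * φ y * fderiv ℝ f y (q.inverse (fderiv ℝ φ y)) := by
  have hsymm : fderiv ℝ φ y (q.inverse (fderiv ℝ f y)) = fderiv ℝ f y (q.inverse (fderiv ℝ φ y)) := by
    rw [← apply_inverse hq, hs, apply_inverse hq]
  have hg : coordGrad (conformalForm q φ) f = fun z ↦ φ z ^ 2 • q.inverse (fderiv ℝ f z) :=
    funext fun z ↦ coordGrad_conformalForm hq hφ0 z
  have hd := (hφ.differentiable (by simp) y).hasFDerivAt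
  have hD : ∀ u, coordDerivGrad (conformalForm q φ) f y u =
      φ y ^ 2 • q.inverse (fderiv ℝ (fderiv ℝ f) y u) +
        (φ y * fderiv ℝ φ y u) • q.inverse (fderiv ℝ f y) +
        (φ y * fderiv ℝ f y u) • q.inverse (fderiv ℝ φ y) -
        (φ y * fderiv ℝ f y (q.inverse (fderiv ℝ φ y))) • u := by
    intro u
    have h1 : fderiv ℝ (fun z ↦ φ z ^ 2 • q.inverse (fderiv ℝ f z)) y u =
        φ y ^ 2 • q.inverse (fderiv ℝ (fderiv ℝ f) y u) +
          (2 * φ y * fderiv ℝ φ y u) • q.inverse (fderiv ℝ f y) := by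
      refine (congrArg (fun L ↦ L u)
        ((hd.pow 2).smul (hasFDerivAt_inverse_fderiv q hf y)).fderiv).trans ?_
      simp
    have hm : ∀ x (c : ℝ) z, q x (c • z) = c * q x z := fun x c z ↦
      ContinuousLinearMap.map_smul (q x) c z
    rw [coordDerivGrad, hg, h1, christoffel_conformalForm hq hφ hφ0]
    simp only [hm, map_smul, smul_eq_mul, hsymm, hs u, apply_inverse hq]
    have := hφ0 y
    match_scalars <;> field_simp <;> ring
  have h1 : ∀ (a : E →L[ℝ] ℝ) z, ∑ i, a (Module.finBasis ℝ E i) * (Module.finBasis ℝ E).repr z i =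
    a z := fun a z ↦ sum_repr_smul (Module.finBasis ℝ E) (a : E →ₗ[ℝ] ℝ) z
  simp only [coordLaplacian, hD, map_sub, map_add, map_smul,
    Finsupp.sub_apply, Finsupp.add_apply, Finsupp.smul_apply, Finset.sum_sub_distrib,
    Finset.sum_add_distrib, smul_eq_mul, ← Finset.mul_sum, sum_repr_self, h1, mul_assoc, hsymm]
  rw [← dAlembertian]
  ring

end ConformalCoordinates

/-! ### The pseudo-Euclidean form in coordinates -/

section PseudoEuclidean

variable {n : ℕ} {ε : Fin n → ℝ}

theorem isInvertible_pseudoEuclideanForm (hε : ∀ i, ε i = 1 ∨ ε i = -1) :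
    (pseudoEuclideanForm ε).IsInvertible :=
  isInvertible_of_nondegenerate _ (pseudoEuclideanForm_nondegenerate hε)

theorem pseudoEuclideanForm_single_single (i j : Fin n) :
    pseudoEuclideanForm ε (EuclideanSpace.single i 1) (EuclideanSpace.single j 1) =
      if i = j then ε i else 0 := by
  rcases eq_or_ne i j with rfl | hij
  · simp [pseudoEuclideanForm_apply]
  · simp [pseudoEuclideanForm_apply, hij, hij.symm]

/-- The matrix diag(ε) is its own inverse because ε_k² = 1. -/
theorem inverse_pseudoEuclideanForm_apply (hε : ∀ i, ε i = 1 ∨ ε i = -1)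
    (L : EuclideanSpace ℝ (Fin n) →L[ℝ] ℝ) (k : Fin n) :
    (pseudoEuclideanForm ε).inverse L k = ε k * L (EuclideanSpace.single k 1) := by
  have h := apply_inverse (isInvertible_pseudoEuclideanForm hε) L (EuclideanSpace.single k 1)
  have hk : ε k * ε k = 1 := by rcases hε k with h | h <;> simp [h]
  rw [← h, pseudoEuclideanForm_apply]
  simp [← mul_assoc, hk]

theorem apply_inverse_pseudoEuclideanForm (hε : ∀ i, ε i = 1 ∨ ε i = -1)
    (L L' : EuclideanSpace ℝ (Fin n) →L[ℝ] ℝ) :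
    L ((pseudoEuclideanForm ε).inverse L') =
      ∑ k, ε k * (L (EuclideanSpace.single k 1) * L' (EuclideanSpace.single k 1)) := by
  have h := sum_repr_smul (EuclideanSpace.basisFun (Fin n) ℝ).toBasis
    (L : EuclideanSpace ℝ (Fin n) →ₗ[ℝ] ℝ) ((pseudoEuclideanForm ε).inverse L')
  refine h.symm.trans (Finset.sum_congr rfl fun k _ ↦ ?_)
  simp [inverse_pseudoEuclideanForm_apply hε]
  ring

theorem partialDeriv_partialDeriv {u : EuclideanSpace ℝ (Fin n) → ℝ} (hu : ContDiff ℝ ∞ u)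
    (i j : Fin n) (x : EuclideanSpace ℝ (Fin n)) :
    partialDeriv j (partialDeriv i u) x =
      fderiv ℝ (fderiv ℝ u) x (EuclideanSpace.single j 1) (EuclideanSpace.single i 1) :=
  fderiv_fderiv_apply hu.contDiffAt _ _

/-- Basis independence of the trace allows the standard basis. -/
theorem dAlembertian_pseudoEuclideanForm (hε : ∀ i, ε i = 1 ∨ ε i = -1)
    {u : EuclideanSpace ℝ (Fin n) → ℝ} (hu : ContDiff ℝ ∞ u) (x : EuclideanSpace ℝ (Fin n)) :
    dAlembertian (pseudoEuclideanForm ε) u x =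
      ∑ k, ε k * partialDeriv k (partialDeriv k u) x := by
  let L : EuclideanSpace ℝ (Fin n) →ₗ[ℝ] EuclideanSpace ℝ (Fin n) :=
    ((pseudoEuclideanForm ε).inverse ∘L fderiv ℝ (fderiv ℝ u) x :
      EuclideanSpace ℝ (Fin n) →L[ℝ] EuclideanSpace ℝ (Fin n))
  refine (sum_repr_eq_trace (Module.finBasis ℝ (EuclideanSpace ℝ (Fin n))) L).trans
    ((sum_repr_eq_trace (EuclideanSpace.basisFun (Fin n) ℝ).toBasis L).symm.trans ?_)
  refine Finset.sum_congr rfl fun k _ ↦ ?_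
  simp [L, inverse_pseudoEuclideanForm_apply hε, partialDeriv_partialDeriv hu]

theorem bilin_eq_zero_iff
    (S : EuclideanSpace ℝ (Fin n) →L[ℝ] EuclideanSpace ℝ (Fin n) →L[ℝ] ℝ) :
    (∀ a b, S a b = 0) ↔
      ∀ i j, S (EuclideanSpace.single i 1) (EuclideanSpace.single j 1) = 0 := by
  refine ⟨fun h i j ↦ h _ _, fun h a b ↦ ?_⟩
  have h1 : ∀ i, (S (EuclideanSpace.single i 1) : EuclideanSpace ℝ (Fin n) →ₗ[ℝ] ℝ) = 0 :=
    fun i ↦ (EuclideanSpace.basisFun (Fin n) ℝ).toBasis.ext fun j ↦ by simpa using h i j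
  have h2 : (S.flip b : EuclideanSpace ℝ (Fin n) →ₗ[ℝ] ℝ) = 0 :=
    (EuclideanSpace.basisFun (Fin n) ℝ).toBasis.ext fun i ↦ by
      simpa using LinearMap.congr_fun (h1 i) b
  exact LinearMap.congr_fun h2 a

/-- The charts of the model space are the identity, so the equality is global. -/
theorem inChart_conformalMetric (hε : ∀ i, ε i = 1 ∨ ε i = -1)
    {φ : EuclideanSpace ℝ (Fin n) → ℝ} (hφ : ContDiff ℝ ∞ φ) (hφ0 : ∀ x, φ x ≠ 0)
    (x : EuclideanSpace ℝ (Fin n)) :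
    (conformalMetric ε hε φ hφ hφ0).inChart x = conformalForm (pseudoEuclideanForm ε) φ := by
  funext y
  have h : (mfderiv 𝓘(ℝ, EuclideanSpace ℝ (Fin n)) (𝓡 n)
      (extChartAt (𝓡 n) x).symm y : EuclideanSpace ℝ (Fin n) →L[ℝ] EuclideanSpace ℝ (Fin n)) =
      ContinuousLinearMap.id ℝ _ := by
    have h1 : ((extChartAt (𝓡 n) x).symm : EuclideanSpace ℝ (Fin n) → EuclideanSpace ℝ (Fin n)) =
        id := by
      rw [extChartAt_model_space_eq_id]
      rfl
    have key : ∀ F : EuclideanSpace ℝ (Fin n) → EuclideanSpace ℝ (Fin n), F = id →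
        (mfderiv 𝓘(ℝ, EuclideanSpace ℝ (Fin n)) (𝓡 n) F y :
          EuclideanSpace ℝ (Fin n) →L[ℝ] EuclideanSpace ℝ (Fin n)) =
        ContinuousLinearMap.id ℝ _ := by
      rintro _ rfl
      exact mfderiv_id
    exact key _ h1
  rw [SemiRiemannianMetric.inChart, h]
  rfl

end PseudoEuclidean

/-! ### Separating the base and fibre components -/

section Splitting

/-- If `B` is a nonzero form, then an equation between forms `T + c B` and `r (A + s B)` on a
product splits into its two components. -/
theorem forall_prod_bilin_eq_iff {E E' : Type*} [NormedAddCommGroup E] [NormedSpace ℝ E]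
    [NormedAddCommGroup E'] [NormedSpace ℝ E'] [Nontrivial E'] {T : E → E → ℝ}
    (hT : T 0 0 = 0) {A : E →L[ℝ] E →L[ℝ] ℝ} {B : E' →L[ℝ] E' →L[ℝ] ℝ} (hB : B.IsInvertible)
    (c r s : ℝ) :
    (∀ a b : E × E', T a.1 b.1 + c * B a.2 b.2 = r * (A a.1 b.1 + s * B a.2 b.2)) ↔
      (∀ a b, T a b = r * A a b) ∧ c = r * s := by
  refine ⟨fun h ↦ ⟨fun a b ↦ by simpa using h (a, 0) (b, 0), ?_⟩, fun h a b ↦ ?_⟩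
  -- A nonzero fibre vector exists, and nondegeneracy provides a partner with B(a, b) ≠ 0, by which
  -- the vertical equation is divided.
  · obtain ⟨a, ha⟩ := exists_ne (0 : E')
    obtain ⟨b, hb⟩ : ∃ b, B a b ≠ 0 := by
      by_contra! h0
      exact ha (hB.injective (by ext b; simpa using h0 b))
    have := h (0, a) (0, b)
    simp only [hT, map_zero, zero_add] at this
    exact mul_right_cancel₀ hb (by linear_combination this)
  · rw [h.1, h.2]
    ring

end Splitting

/-! ### The soliton equation at a point -/

section Soliton

/-- The system of the warped product at the point `x`, where the value of `ρ` is `r`. -/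
structure WarpedSolitonSystemAt {n : ℕ} (ε : Fin n → ℝ) (m : ℕ) (c : ℝ)
    (φ f h : EuclideanSpace ℝ (Fin n) → ℝ) (x : EuclideanSpace ℝ (Fin n)) (r : ℝ) : Prop where
  offDiagonal : ∀ i j : Fin n, i ≠ j →
    ((n : ℝ) - 2) * f x * partialDeriv j (partialDeriv i φ) x
      + f x * φ x * partialDeriv j (partialDeriv i h) x
      - m * φ x * partialDeriv j (partialDeriv i f) x
      - m * partialDeriv i φ x * partialDeriv j f x
      - m * partialDeriv j φ x * partialDeriv i f x
      + f x * partialDeriv i φ x * partialDeriv j h x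
      + f x * partialDeriv j φ x * partialDeriv i h x = 0
  diagonal : ∀ i : Fin n,
    φ x * (((n : ℝ) - 2) * f x * partialDeriv i (partialDeriv i φ) x
        + f x * φ x * partialDeriv i (partialDeriv i h) x
        - m * φ x * partialDeriv i (partialDeriv i f) x
        - 2 * m * partialDeriv i φ x * partialDeriv i f x
        + 2 * f x * partialDeriv i φ x * partialDeriv i h x)
      + ε i * ∑ k, ε k * (f x * φ x * partialDeriv k (partialDeriv k φ) x
        - ((n : ℝ) - 1) * f x * partialDeriv k φ x ^ 2
        + m * φ x * partialDeriv k φ x * partialDeriv k f x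
        - f x * φ x * partialDeriv k φ x * partialDeriv k h x)
      = ε i * r * f x
  fiber :
    ∑ k, ε k * (-(f x * φ x ^ 2 * partialDeriv k (partialDeriv k f) x)
        + ((n : ℝ) - 2) * f x * φ x * partialDeriv k f x * partialDeriv k φ x
        - ((m : ℝ) - 1) * φ x ^ 2 * partialDeriv k f x ^ 2
        + f x * φ x ^ 2 * partialDeriv k f x * partialDeriv k h x)
      = r * f x ^ 2 - c

variable {n m : ℕ} {ε : Fin n → ℝ} {c : ℝ} {φ f h ρ : EuclideanSpace ℝ (Fin n) → ℝ}

theorem warpedSolitonSystem_iff_forall_at :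
    WarpedSolitonSystem ε m c φ f h ρ ↔ ∀ x, WarpedSolitonSystemAt ε m c φ f h x (ρ x) :=
  ⟨fun H x ↦ ⟨H.offDiagonal x, H.diagonal x, H.fiber x⟩,
    fun H ↦ ⟨fun x ↦ (H x).offDiagonal, fun x ↦ (H x).diagonal, fun x ↦ (H x).fiber⟩⟩

theorem base_equation_iff (hε : ∀ i, ε i = 1 ∨ ε i = -1)
    (hφ : ContDiff ℝ ∞ φ) (hφ0 : ∀ x, φ x ≠ 0) (hf : ContDiff ℝ ∞ f) (hf0 : ∀ x, 0 < f x)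
    (hh : ContDiff ℝ ∞ h) (x : EuclideanSpace ℝ (Fin n)) (r : ℝ) :
    (∀ a b, coordRicci (conformalForm (pseudoEuclideanForm ε) φ) x a b -
        m / f x * coordHess (conformalForm (pseudoEuclideanForm ε) φ) f x a b +
        coordHess (conformalForm (pseudoEuclideanForm ε) φ) h x a b =
        r * conformalForm (pseudoEuclideanForm ε) φ x a b) ↔
      (∀ i j : Fin n, i ≠ j →
        ((n : ℝ) - 2) * f x * partialDeriv j (partialDeriv i φ) x
          + f x * φ x * partialDeriv j (partialDeriv i h) x
          - m * φ x * partialDeriv j (partialDeriv i f) x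
          - m * partialDeriv i φ x * partialDeriv j f x
          - m * partialDeriv j φ x * partialDeriv i f x
          + f x * partialDeriv i φ x * partialDeriv j h x
          + f x * partialDeriv j φ x * partialDeriv i h x = 0) ∧
      ∀ i : Fin n,
        φ x * (((n : ℝ) - 2) * f x * partialDeriv i (partialDeriv i φ) x
            + f x * φ x * partialDeriv i (partialDeriv i h) x
            - m * φ x * partialDeriv i (partialDeriv i f) x
            - 2 * m * partialDeriv i φ x * partialDeriv i f x
            + 2 * f x * partialDeriv i φ x * partialDeriv i h x)
          + ε i * ∑ k, ε k * (f x * φ x * partialDeriv k (partialDeriv k φ) x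
            - ((n : ℝ) - 1) * f x * partialDeriv k φ x ^ 2
            + m * φ x * partialDeriv k φ x * partialDeriv k f x
            - f x * φ x * partialDeriv k φ x * partialDeriv k h x)
          = ε i * r * f x := by
  have hq := isInvertible_pseudoEuclideanForm hε
  have hs := pseudoEuclideanForm_symm ε
  have hφx := hφ0 x
  have hfx := (hf0 x).ne'
  have hpd : ∀ u k, fderiv ℝ u x (EuclideanSpace.single k 1) = partialDeriv k u x :=
    fun _ _ ↦ rfl
  set q := pseudoEuclideanForm ε with hqdef
  -- The constant κ collects every coefficient of q, including -r / φ² from the right-hand side.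
  set κ : ℝ := (φ x)⁻¹ * dAlembertian q φ x -
    ((n : ℝ) - 1) * (fderiv ℝ φ x (q.inverse (fderiv ℝ φ x)) / φ x ^ 2) +
    m / f x * ((φ x)⁻¹ * fderiv ℝ f x (q.inverse (fderiv ℝ φ x))) -
    (φ x)⁻¹ * fderiv ℝ h x (q.inverse (fderiv ℝ φ x)) - r / φ x ^ 2 with hκ
  -- The difference of the two sides, bundled as a bilinear form so that its vanishing can be tested
  -- on basis vectors.
  let S : EuclideanSpace ℝ (Fin n) →L[ℝ] EuclideanSpace ℝ (Fin n) →L[ℝ] ℝ :=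
    (((n : ℝ) - 2) * (φ x)⁻¹) • fderiv ℝ (fderiv ℝ φ) x + fderiv ℝ (fderiv ℝ h) x -
      (m / f x) • fderiv ℝ (fderiv ℝ f) x +
      (fderiv ℝ φ x).smulRight ((φ x)⁻¹ • (fderiv ℝ h x - (m / f x) • fderiv ℝ f x)) +
      ((φ x)⁻¹ • (fderiv ℝ h x - (m / f x) • fderiv ℝ f x)).smulRight (fderiv ℝ φ x) + κ • q
  have hS : ∀ a b, S a b = ((n : ℝ) - 2) * (φ x)⁻¹ * fderiv ℝ (fderiv ℝ φ) x a b +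
      fderiv ℝ (fderiv ℝ h) x a b - m / f x * fderiv ℝ (fderiv ℝ f) x a b +
      fderiv ℝ φ x a * ((φ x)⁻¹ * (fderiv ℝ h x b - m / f x * fderiv ℝ f x b)) +
      (φ x)⁻¹ * (fderiv ℝ h x a - m / f x * fderiv ℝ f x a) * fderiv ℝ φ x b + κ * q a b :=
    fun a b ↦ rfl
  have key : ∀ a b, (coordRicci (conformalForm q φ) x a b -
        m / f x * coordHess (conformalForm q φ) f x a b + coordHess (conformalForm q φ) h x a b =
        r * conformalForm q φ x a b) ↔ S a b = 0 := by
    intro a b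
    rw [coordRicci_conformalForm hq hs hφ hφ0, coordHess_conformalForm hq hφ hφ0 hf,
      coordHess_conformalForm hq hφ hφ0 hh, conformalForm_apply, ← sub_eq_zero, hS,
      finrank_euclideanSpace_fin, hκ]
    refine Eq.congr_left ?_
    ring
  simp only [key]
  rw [bilin_eq_zero_iff]
  -- The sum in the diagonal equation is f φ² times κ without its term -r / φ², which accounts for r
  -- f.
  have hsum : ∑ k, ε k * (f x * φ x * partialDeriv k (partialDeriv k φ) x
            - ((n : ℝ) - 1) * f x * partialDeriv k φ x ^ 2
            + m * φ x * partialDeriv k φ x * partialDeriv k f x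
            - f x * φ x * partialDeriv k φ x * partialDeriv k h x) =
      f x * φ x ^ 2 * κ + r * f x := by
    rw [hκ, hqdef, dAlembertian_pseudoEuclideanForm hε hφ]
    simp only [apply_inverse_pseudoEuclideanForm hε, hpd]
    have h1 : ∀ k, ε k * (f x * φ x * partialDeriv k (partialDeriv k φ) x
            - ((n : ℝ) - 1) * f x * partialDeriv k φ x ^ 2
            + m * φ x * partialDeriv k φ x * partialDeriv k f x
            - f x * φ x * partialDeriv k φ x * partialDeriv k h x) =
        f x * φ x * (ε k * partialDeriv k (partialDeriv k φ) x)
            - ((n : ℝ) - 1) * f x * (ε k * (partialDeriv k φ x * partialDeriv k φ x))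
            + m * φ x * (ε k * (partialDeriv k f x * partialDeriv k φ x))
            - f x * φ x * (ε k * (partialDeriv k h x * partialDeriv k φ x)) := fun k ↦ by ring
    simp only [h1, Finset.sum_sub_distrib, Finset.sum_add_distrib, ← Finset.mul_sum]
    field_simp
    ring
  rw [hsum]
  -- The iterated partials appear in the opposite order; symmetry of second derivatives reconciles
  -- them.
  have hS' : ∀ i j, S (EuclideanSpace.single i 1) (EuclideanSpace.single j 1) =
      ((n : ℝ) - 2) * (φ x)⁻¹ * partialDeriv j (partialDeriv i φ) x +
      partialDeriv j (partialDeriv i h) x - m / f x * partialDeriv j (partialDeriv i f) x +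
      partialDeriv i φ x * ((φ x)⁻¹ * (partialDeriv j h x - m / f x * partialDeriv j f x)) +
      (φ x)⁻¹ * (partialDeriv i h x - m / f x * partialDeriv i f x) * partialDeriv j φ x +
      κ * if i = j then ε i else 0 := by
    intro i j
    rw [hS, hqdef, pseudoEuclideanForm_single_single, partialDeriv_partialDeriv hφ,
      partialDeriv_partialDeriv hf, partialDeriv_partialDeriv hh,
      fderiv_fderiv_comm hφ.contDiffAt, fderiv_fderiv_comm hf.contDiffAt,
      fderiv_fderiv_comm hh.contDiffAt]
    rfl
  simp only [hS']
  constructor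
  · refine fun H ↦ ⟨fun i j hij ↦ ?_, fun i ↦ ?_⟩
    · have := H i j
      simp only [hij, if_false, mul_zero, add_zero] at this
      field_simp at this
      linear_combination this
    · have := H i i
      simp only [if_true] at this
      field_simp at this
      linear_combination φ x * this
  · rintro ⟨H1, H2⟩ i j
    rcases eq_or_ne i j with rfl | hij
    · have := H2 i
      simp only [if_true]
      field_simp
      refine mul_left_cancel₀ hφx ?_
      linear_combination this
    · have := H1 i j hij
      simp only [hij, if_false, mul_zero, add_zero]
      field_simp
      linear_combination this

theorem fiber_equation_iff (hε : ∀ i, ε i = 1 ∨ ε i = -1)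
    (hφ : ContDiff ℝ ∞ φ) (hφ0 : ∀ x, φ x ≠ 0) (hf : ContDiff ℝ ∞ f)
    (x : EuclideanSpace ℝ (Fin n)) (r : ℝ) :
    (c - (f x * coordLaplacian (conformalForm (pseudoEuclideanForm ε) φ) f x +
        ((m : ℝ) - 1) * fderiv ℝ f x (coordGrad (conformalForm (pseudoEuclideanForm ε) φ) f x)) +
        f x * fderiv ℝ h x (coordGrad (conformalForm (pseudoEuclideanForm ε) φ) f x) =
      r * f x ^ 2) ↔
    ∑ k, ε k * (-(f x * φ x ^ 2 * partialDeriv k (partialDeriv k f) x)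
        + ((n : ℝ) - 2) * f x * φ x * partialDeriv k f x * partialDeriv k φ x
        - ((m : ℝ) - 1) * φ x ^ 2 * partialDeriv k f x ^ 2
        + f x * φ x ^ 2 * partialDeriv k f x * partialDeriv k h x)
      = r * f x ^ 2 - c := by
  have hq := isInvertible_pseudoEuclideanForm hε
  rw [coordLaplacian_conformalForm hq (pseudoEuclideanForm_symm ε) hφ hφ0 hf,
    coordGrad_conformalForm hq hφ0, dAlembertian_pseudoEuclideanForm hε hf,
    finrank_euclideanSpace_fin, eq_sub_iff_add_eq]
  have hpd : ∀ u k, fderiv ℝ u x (EuclideanSpace.single k 1) = partialDeriv k u x :=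
    fun _ _ ↦ rfl
  simp only [map_smul, smul_eq_mul, apply_inverse_pseudoEuclideanForm hε, hpd]
  refine Eq.congr_left ?_
  have h1 : ∀ k, ε k * (-(f x * φ x ^ 2 * partialDeriv k (partialDeriv k f) x)
        + ((n : ℝ) - 2) * f x * φ x * partialDeriv k f x * partialDeriv k φ x
        - ((m : ℝ) - 1) * φ x ^ 2 * partialDeriv k f x ^ 2
        + f x * φ x ^ 2 * partialDeriv k f x * partialDeriv k h x) =
      ((n : ℝ) - 2) * f x * φ x * (ε k * (partialDeriv k f x * partialDeriv k φ x))
        - f x * φ x ^ 2 * (ε k * partialDeriv k (partialDeriv k f) x)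
        - ((m : ℝ) - 1) * φ x ^ 2 * (ε k * (partialDeriv k f x * partialDeriv k f x))
        + f x * φ x ^ 2 * (ε k * (partialDeriv k h x * partialDeriv k f x)) := fun k ↦ by ring
  simp only [h1, Finset.sum_sub_distrib, Finset.sum_add_distrib, ← Finset.mul_sum]
  ring

/-- The statement is at one point and for a real number r, so that it applies to functions on M that
are not assumed to come from the base. -/
theorem ricci_add_hess_warpedProduct_iff (hm : 1 ≤ m) (hε : ∀ i, ε i = 1 ∨ ε i = -1)
    (hφ : ContDiff ℝ ∞ φ) (hφ0 : ∀ x, φ x ≠ 0) (hf : ContDiff ℝ ∞ f) (hf0 : ∀ x, 0 < f x)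
    (hh : ContDiff ℝ ∞ h)
    {F : Type*} [TopologicalSpace F] [ChartedSpace (EuclideanSpace ℝ (Fin m)) F]
    [IsManifold (𝓡 m) ∞ F] (gF : SemiRiemannianMetric (𝓡 m) F) (hF : gF.IsEinstein c)
    (p : EuclideanSpace ℝ (Fin n) × F) (r : ℝ) :
    (∀ u v : TangentSpace ((𝓡 n).prod (𝓡 m)) p,
      (warpedProduct (conformalMetric ε hε φ hφ hφ0) f hf.contMDiff hf0 gF).ricci p u v +
        (warpedProduct (conformalMetric ε hε φ hφ hφ0) f hf.contMDiff hf0 gF).hess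
          (fun p ↦ h p.1) p u v =
        r * (warpedProduct (conformalMetric ε hε φ hφ hφ0) f hf.contMDiff hf0 gF).inner p u v) ↔
      WarpedSolitonSystemAt ε m c φ f h p.1 r := by
  have hpt : extChartAt ((𝓡 n).prod (𝓡 m)) p p = (p.1, extChartAt (𝓡 m) p.2 p.2) := by
    rw [extChartAt_prod]
    rfl
  have hhc : (fun p : EuclideanSpace ℝ (Fin n) × F ↦ h p.1) ∘
      (extChartAt ((𝓡 n).prod (𝓡 m)) p).symm = fun z ↦ h z.1 := by
    rw [extChartAt_prod]
    rfl
  have hfc : f ∘ (extChartAt (𝓡 n) p.1).symm = f := rfl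
  have hW := inChart_warpedProduct (conformalMetric ε hε φ hφ hφ0) f hf.contMDiff hf0 gF p
  rw [inChart_conformalMetric, hfc, hpt] at hW
  have hq := isInvertible_pseudoEuclideanForm hε
  have hA := (contDiff_conformalForm (q := pseudoEuclideanForm ε) hφ hφ0).contDiffAt (x := p.1)
  have hAi := isInvertible_conformalForm (φ := φ) hq (hφ0 p.1)
  have hB := gF.contDiffAt_inChart p.2
  have hBi := gF.isInvertible_inChart p.2
  have hBs := gF.inChart_symm p.2
  have hE := (gF.ricci_eq_iff p.2 c).1 (hF p.2)
  -- Positive fibre dimension makes the fibre model space nontrivial, as the splitting requires.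
  have : Nonempty (Fin m) := ⟨⟨0, hm⟩⟩
  rw [SemiRiemannianMetric.ricci_add_hess_eq_iff, hhc, hpt]
  simp only [coordRicci_congr hW, coordHess_congr hW Filter.EventuallyEq.rfl, hW.self_of_nhds]
  simp only [coordRicci_warpedForm (p := (p.1, extChartAt (𝓡 m) p.2 p.2)) hA hf.contDiffAt hB hAi
      (hf0 p.1).ne' hBi hBs,
    coordHess_warpedForm (p := (p.1, extChartAt (𝓡 m) p.2 p.2)) hA hf.contDiffAt hB hAi
      (hf0 p.1).ne' hBi hBs hh.contDiffAt, warpedForm_apply, hE, finrank_euclideanSpace_fin]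
  have hsplit := forall_prod_bilin_eq_iff (T := fun a b ↦
      coordRicci (conformalForm (pseudoEuclideanForm ε) φ) p.1 a b -
        m / f p.1 * coordHess (conformalForm (pseudoEuclideanForm ε) φ) f p.1 a b +
        coordHess (conformalForm (pseudoEuclideanForm ε) φ) h p.1 a b)
    (by simp [coordRicci_conformalForm hq (pseudoEuclideanForm_symm ε) hφ hφ0,
      coordHess_conformalForm hq hφ hφ0 hf, coordHess_conformalForm hq hφ hφ0 hh])
    (A := conformalForm (pseudoEuclideanForm ε) φ p.1) hBi
    (c - (f p.1 * coordLaplacian (conformalForm (pseudoEuclideanForm ε) φ) f p.1 +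
        ((m : ℝ) - 1) * fderiv ℝ f p.1 (coordGrad (conformalForm (pseudoEuclideanForm ε) φ) f p.1)) +
        f p.1 * fderiv ℝ h p.1 (coordGrad (conformalForm (pseudoEuclideanForm ε) φ) f p.1))
    r (f p.1 ^ 2)
  rw [base_equation_iff hε hφ hφ0 hf hf0 hh, fiber_equation_iff hε hφ hφ0 hf] at hsplit
  refine Iff.trans (forall₂_congr fun a b ↦ Eq.congr_left ?_) (hsplit.trans
    ⟨fun H ↦ ⟨H.1.1, H.1.2, H.2⟩, fun H ↦ ⟨⟨H.offDiagonal, H.diagonal⟩, H.fiber⟩⟩)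
  ring

end Soliton

end SemiRiem

end

/-! ### From points to functions -/

theorem theorem1p3 {n m : ℕ} (hn : 3 ≤ n) (hm : 1 ≤ m)
    (ε : Fin n → ℝ) (hε : ∀ i, ε i = 1 ∨ ε i = -1)
    (φ f h : EuclideanSpace ℝ (Fin n) → ℝ)
    (hφ : ContDiff ℝ ∞ φ) (hφ0 : ∀ x, φ x ≠ 0)
    (hf : ContDiff ℝ ∞ f) (hf0 : ∀ x, 0 < f x) (hh : ContDiff ℝ ∞ h)
    {F : Type*} [TopologicalSpace F] [ChartedSpace (EuclideanSpace ℝ (Fin m)) F]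
    [IsManifold (𝓡 m) ∞ F] [Nonempty F]
    (gF : SemiRiem.SemiRiemannianMetric (𝓡 m) F) (lamF : ℝ) (hF : gF.IsEinstein lamF) :
    (∀ ρ : EuclideanSpace ℝ (Fin n) → ℝ, ContDiff ℝ ∞ ρ →
      ((SemiRiem.warpedProduct (SemiRiem.conformalMetric ε hε φ hφ hφ0) f hf.contMDiff hf0
          gF).AlmostSolitonEquation (fun p ↦ h p.1) (fun p ↦ ρ p.1) ↔
        SemiRiem.WarpedSolitonSystem ε m lamF φ f h ρ)) ∧
    ((SemiRiem.warpedProduct (SemiRiem.conformalMetric ε hε φ hφ hφ0) f hf.contMDiff hf0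
        gF).IsGradientRicciAlmostSoliton (fun p ↦ h p.1) ↔
      ∃ ρ : EuclideanSpace ℝ (Fin n) → ℝ, ContDiff ℝ ∞ ρ ∧
        SemiRiem.WarpedSolitonSystem ε m lamF φ f h ρ) := by
  have key := SemiRiem.ricci_add_hess_warpedProduct_iff hm hε hφ hφ0 hf hf0 hh gF hF
  obtain ⟨q₀⟩ := ‹Nonempty F›
  have hpull : ∀ u : EuclideanSpace ℝ (Fin n) → ℝ, ContDiff ℝ ∞ u →
      ContMDiff ((𝓡 n).prod (𝓡 m)) 𝓘(ℝ, ℝ) ∞ (fun p : EuclideanSpace ℝ (Fin n) × F ↦ u p.1) :=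
    fun u hu ↦ hu.contMDiff.comp contMDiff_fst
  have h1 : ∀ ρ : EuclideanSpace ℝ (Fin n) → ℝ,
      (SemiRiem.warpedProduct (SemiRiem.conformalMetric ε hε φ hφ hφ0) f hf.contMDiff hf0
          gF).AlmostSolitonEquation (fun p ↦ h p.1) (fun p ↦ ρ p.1) ↔
        SemiRiem.WarpedSolitonSystem ε m lamF φ f h ρ := fun ρ ↦ by
    rw [SemiRiem.warpedSolitonSystem_iff_forall_at]
    -- One fibre point suffices to obtain the system; conversely, the system at x gives the equation
    -- at every point over x.
    exact ⟨fun H x ↦ (key (x, q₀) (ρ x)).1 (H (x, q₀)), fun H p ↦ (key p (ρ p.1)).2 (H p.1)⟩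
  refine ⟨fun ρ _ ↦ h1 ρ, ?_, ?_⟩
  · rintro ⟨-, ρ, hρ, H⟩
    -- The witness is the restriction to the slice through q₀, smooth as a composition with x ↦ (x,
    -- q₀).
    refine ⟨fun x ↦ ρ (x, q₀), ?_, SemiRiem.warpedSolitonSystem_iff_forall_at.2 fun x ↦
      (key (x, q₀) _).1 (H (x, q₀))⟩
    exact (hρ.comp (contMDiff_id.prodMk contMDiff_const)).contDiff
  · rintro ⟨ρ, hρ, H⟩
    exact ⟨hpull h hh, fun p ↦ ρ p.1, hpull ρ hρ, (h1 ρ).2 H⟩
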